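/- Let $E,F$ be real Fréchet spaces. A curve $c:\mathbb R\to E$ is called smooth if all its derivatives exist and are continuous, and a subset $U\subseteq E$ is called $c^\infty$-open if $c^{-1}(U)$ is open in $\mathbb R$ for every smooth curve $c:\mathbb R\to E$. Let $U\subseteq E$ be $c^\infty$-open. Then $U$ is open in $E$, and a map $f:U\to F$ is Gâteaux (Michal–Bastiani) smooth if and only if it is convenient smooth. Here $f$ is called convenient smooth if $f\circ c:\mathbb R\to F$ is a smooth curve for every smooth curve $c:\mathbb R\to E$ with $c(\mathbb R)\subseteq U$. For a map $f$ on an open subset $U$ of a Fréchet space $E$, being $C^k$ in the sense of Gâteaux is defined inductively: $C^0$ means continuous; $f$ is $C^{k+1}$ if it is continuous, the limit $$\partial f(x,h):=\lim_{t\to 0}\frac{f(x+th)-f(x)}{t}$$ exists in $F$ for all $x\in U$ and $h\in E$, and $\partial f:U\times E\to F$ is $C^k$ on the open subset $U\times E$ of the Fréchet space $E\times E$. The map $f$ is Gâteaux smooth if it is $C^k$ in this sense for every $k\in\mathbb N$. -/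

import Mathlib

open Filter Topology Set

universe u v

/-- A curve `c : ℝ → E` in a topological vector space is smooth if all its derivatives
`c = d 0, d 1, d 2, …` exist and are continuous. -/
def IsSmoothCurve {E : Type u} [AddCommGroup E] [Module ℝ E] [TopologicalSpace E]
    [ContinuousSMul ℝ E] (c : ℝ → E) : Prop :=
  ∃ d : ℕ → ℝ → E, d 0 = c ∧
    ∀ n, Continuous (d n) ∧ ∀ t, HasDerivAt (d n) (d (n + 1) t) t

/-- `U` is `c^∞`-open: its preimage under every smooth curve is open in `ℝ`. -/
def IsCInftyOpen {E : Type u} [AddCommGroup E] [Module ℝ E] [TopologicalSpace E]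
    [ContinuousSMul ℝ E] (U : Set E) : Prop :=
  ∀ c : ℝ → E, IsSmoothCurve c → IsOpen (c ⁻¹' U)

/-- `f : U → F` (only the values of `f` on `U` matter) is convenient smooth: it maps smooth
curves in `U` to smooth curves in `F`. -/
def ConvenientSmoothOn {E : Type u} {F : Type v}
    [AddCommGroup E] [Module ℝ E] [TopologicalSpace E] [ContinuousSMul ℝ E]
    [AddCommGroup F] [Module ℝ F] [TopologicalSpace F] [ContinuousSMul ℝ F]
    (f : E → F) (U : Set E) : Prop :=
  ∀ c : ℝ → E, IsSmoothCurve c → (∀ t, c t ∈ U) → IsSmoothCurve (f ∘ c)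

/-- `f` has the Gâteaux derivative `y` at `x` in the direction `h`:
`y = lim_{t → 0} (f (x + t h) - f x) / t`. -/
def HasGateauxDerivAt {E : Type u} {F : Type v} [AddCommGroup E] [Module ℝ E]
    [AddCommGroup F] [Module ℝ F] [TopologicalSpace F]
    (f : E → F) (y : F) (x h : E) : Prop :=
  Tendsto (fun t : ℝ => t⁻¹ • (f (x + t • h) - f x)) (𝓝[≠] 0) (𝓝 y)

/-- `f : U → F` (with `U` open; only the values of `f` on `U` matter) is `C^k` in the sense of
Gâteaux (Michal–Bastiani). `C^0` means continuous; `f` is `C^(k+1)` if it is continuous, all its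
directional derivatives `∂f (x, h)`, `x ∈ U`, `h ∈ E`, exist, and `∂f` is `C^k` on the open
subset `U × E` of the product space `E × E`. -/
def GateauxCkOn {F : Type v} [AddCommGroup F] [Module ℝ F] [TopologicalSpace F] :
    (k : ℕ) → {E : Type u} → [AddCommGroup E] → [Module ℝ E] → [TopologicalSpace E] →
      (E → F) → Set E → Prop
  | 0, _, _, _, _, f, U => ContinuousOn f U
  | k + 1, E, _, _, _, f, U => ContinuousOn f U ∧
      ∃ f' : E × E → F, (∀ x ∈ U, ∀ h : E, HasGateauxDerivAt f (f' (x, h)) x h) ∧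
        GateauxCkOn k f' (U ×ˢ (univ : Set E))

/-- `f : U → F` is Gâteaux smooth: it is `C^k` in the sense of Gâteaux for every `k`. -/
def GateauxSmoothOn {E : Type u} {F : Type v} [AddCommGroup E] [Module ℝ E]
    [TopologicalSpace E] [AddCommGroup F] [Module ℝ F] [TopologicalSpace F]
    (f : E → F) (U : Set E) : Prop :=
  ∀ k : ℕ, GateauxCkOn k f U

/-- A real Fréchet space: a real Hausdorff locally convex topological vector space which is
metrizable (the uniformity is countably generated) and complete. -/
class IsFrechetSpace (E : Type u) [AddCommGroup E] [Module ℝ E] [UniformSpace E] : Prop extends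
    IsUniformAddGroup E, ContinuousSMul ℝ E, LocallyConvexSpace ℝ E, T2Space E,
    IsCountablyGenerated (uniformity E), CompleteSpace E

set_option linter.unusedSectionVars false

/-! A sequence converging to `x` faster than every power of `2⁻ⁿ` can be threaded by a smooth curve
(`exists_isSmoothCurve_of_rapidlyDecreasing`). In a first countable space such a sequence can be
chosen inside any set that accumulates at `x`. So failure of openness, of continuity or of local
boundedness of derivatives at `x` would already be visible along one smooth curve.

Gâteaux smooth implies convenient smooth by the chain rule `(f ∘ c)' = f' (c, c')`. Since `(c, c')`
is again a smooth curve, the rule iterates; it rests on the mean value theorem in locally convex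
spaces.

For the converse it suffices that `f'` exists and is again convenient smooth, for then one inducts
on `k`. Along a smooth curve `(c, v)`, `f'` is the derivative in `s` at `0` of `f (c t + s • v t)`.
After a cutoff this is a map `g` on the plane taking smooth curves to smooth curves, and `∂₁ g (0,
t)` must be shown smooth in `t`; this is Boman's theorem (`isSmoothCurve_partialDeriv`). Iterated
derivatives of `g` in a fixed direction exist. They are locally bounded by the curve lemma, hence
continuous by a Taylor estimate (`continuous_lineDerivIter`). Polarization writes `∂₁ ∂₂ⁿ` as a
combination of the `(n + 1)`-st derivatives in the directions `(i, 1)`. The formula is proved for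
mollifications of `l ∘ g`, with `l` a continuous functional. It passes to the limit, and Hahn–Banach
lifts it back to `F`. -/

namespace ConvenientCalculus

/-! ### Differential calculus of curves in topological vector spaces -/

section Calculus

variable {E : Type*} [AddCommGroup E] [Module ℝ E] [TopologicalSpace E]
  [IsTopologicalAddGroup E] [ContinuousSMul ℝ E]
variable {F : Type*} [AddCommGroup F] [Module ℝ F] [TopologicalSpace F]
  [IsTopologicalAddGroup F] [ContinuousSMul ℝ F]

theorem hasDerivAt_iff_tendsto_slope_sub {f : ℝ → E} {y : E} {x : ℝ} :
    HasDerivAt f y x ↔ Tendsto (fun t => (t - x)⁻¹ • (f t - f x - (t - x) • y)) (𝓝 x) (𝓝 0) := by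
  rw [hasDerivAt_iff_hasFDerivAt, hasFDerivAt_iff_isLittleOTVS,
    Asymptotics.isLittleOTVS_iff_tendsto_inv_smul]
  · simp
  · refine Eventually.of_forall fun t ht => ?_
    have : t = x := sub_eq_zero.1 ht
    simp [this]

/-- Carathéodory's characterization of the derivative. -/
theorem hasDerivAt_iff_exists_continuousAt_slope {f : ℝ → E} {y : E} {x : ℝ} :
    HasDerivAt f y x ↔
      ∃ q : ℝ → E, ContinuousAt q x ∧ q x = y ∧ ∀ t, f t = f x + (t - x) • q t := by
  rw [hasDerivAt_iff_tendsto_slope_sub]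
  constructor
  · intro h
    refine ⟨fun t => y + (t - x)⁻¹ • (f t - f x - (t - x) • y), ?_, by simp, fun t => ?_⟩
    · have := (tendsto_const_nhds (x := y)).add h
      simpa [ContinuousAt] using this
    · rcases eq_or_ne t x with rfl | ht
      · simp
      · rw [smul_add, smul_inv_smul₀ (sub_ne_zero.2 ht)]
        abel
  · rintro ⟨q, hq, rfl, h⟩
    have h1 : Tendsto (fun t => q t - q x) (𝓝 x) (𝓝 0) := by
      simpa using hq.tendsto.sub_const (q x)
    refine h1.congr fun t => ?_
    rcases eq_or_ne t x with rfl | ht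
    · simp
    · have : f t - f x - (t - x) • q x = (t - x) • (q t - q x) := by
        rw [h t, smul_sub]; abel
      rw [this, inv_smul_smul₀ (sub_ne_zero.2 ht)]

theorem hasDerivAt_iff_tendsto_slope_zero_right {f : ℝ → E} {y : E} {x : ℝ} :
    HasDerivAt f y x ↔ Tendsto (fun t : ℝ => t⁻¹ • (f (x + t) - f x)) (𝓝[≠] 0) (𝓝 y) := by
  constructor
  · rw [hasDerivAt_iff_exists_continuousAt_slope]
    rintro ⟨q, hq, rfl, h⟩
    have h0 : Tendsto (fun t : ℝ => x + t) (𝓝[≠] 0) (𝓝 x) := by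
      have : Tendsto (fun t : ℝ => x + t) (𝓝 0) (𝓝 (x + 0)) := by
        exact (continuous_const.add continuous_id).tendsto 0
      rw [add_zero] at this
      exact this.mono_left nhdsWithin_le_nhds
    refine (hq.tendsto.comp h0).congr' ?_
    filter_upwards [self_mem_nhdsWithin] with t ht
    have ht' : t ≠ 0 := ht
    rw [Function.comp, h (x + t)]
    simp [inv_smul_smul₀ ht']
  · intro h
    rw [hasDerivAt_iff_tendsto_slope_sub]
    have h0 : Tendsto (fun t : ℝ => t - x) (𝓝[≠] x) (𝓝[≠] 0) := by
      refine tendsto_nhdsWithin_iff.2 ⟨?_, ?_⟩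
      · have : Tendsto (fun t : ℝ => t - x) (𝓝 x) (𝓝 (x - x)) :=
          (continuous_id.sub continuous_const).tendsto x
        rw [sub_self] at this
        exact this.mono_left nhdsWithin_le_nhds
      · filter_upwards [self_mem_nhdsWithin] with t ht
        exact sub_ne_zero.2 ht
    have h1 := (h.comp h0).sub_const y
    rw [sub_self] at h1
    -- The residual is controlled on the punctured neighbourhood; at the centre itself it is `0`.
    rw [← nhdsNE_sup_pure x]
    refine Tendsto.sup (h1.congr' ?_) ?_
    · filter_upwards [self_mem_nhdsWithin] with t ht
      have ht' : t - x ≠ 0 := sub_ne_zero.2 ht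
      simp only [Function.comp, add_sub_cancel]
      rw [smul_sub (t - x)⁻¹ _ ((t - x) • y), inv_smul_smul₀ ht']
    · rw [tendsto_pure_left]
      intro s hs
      simpa using mem_of_mem_nhds hs

theorem continuousAt_of_hasDerivAt {f : ℝ → E} {y : E} {x : ℝ} (h : HasDerivAt f y x) :
    ContinuousAt f x := by
  obtain ⟨q, hq, -, hf⟩ := hasDerivAt_iff_exists_continuousAt_slope.1 h
  rw [funext hf]
  exact continuousAt_const.add ((continuousAt_id.sub continuousAt_const).smul hq)

theorem hasDerivAt_unique [T2Space E] {f : ℝ → E} {y z : E} {x : ℝ} (h : HasDerivAt f y x)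
    (h' : HasDerivAt f z x) : y = z :=
  tendsto_nhds_unique (hasDerivAt_iff_tendsto_slope_zero_right.1 h)
    (hasDerivAt_iff_tendsto_slope_zero_right.1 h')

theorem deriv_eq_of_hasDerivAt [T2Space E] {f : ℝ → E} {y : E} {x : ℝ} (h : HasDerivAt f y x) :
    deriv f x = y :=
  hasDerivAt_unique
    (hasFDerivAt_iff_hasDerivAt.1 (DifferentiableAt.hasFDerivAt ⟨_, h.hasFDerivAt⟩)) h

theorem hasDerivAt_congr {f g : ℝ → E} {y : E} {x : ℝ} (h : HasDerivAt f y x)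
    (hg : g =ᶠ[𝓝 x] f) : HasDerivAt g y x :=
  HasFDerivAt.congr_of_eventuallyEq h hg

theorem hasDerivAt_add {f g : ℝ → E} {y z : E} {x : ℝ} (hf : HasDerivAt f y x)
    (hg : HasDerivAt g z x) : HasDerivAt (fun t => f t + g t) (y + z) x := by
  rw [hasDerivAt_iff_exists_continuousAt_slope] at *
  obtain ⟨p, hp, rfl, hf⟩ := hf
  obtain ⟨q, hq, rfl, hg⟩ := hg
  refine ⟨fun t => p t + q t, hp.add hq, rfl, fun t => ?_⟩
  rw [hf t, hg t, smul_add]; abel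

theorem hasDerivAt_smul {f : ℝ → ℝ} {g : ℝ → E} {y : ℝ} {z : E} {x : ℝ} (hf : HasDerivAt f y x)
    (hg : HasDerivAt g z x) : HasDerivAt (fun t => f t • g t) (f x • z + y • g x) x := by
  have hgc := continuousAt_of_hasDerivAt hg
  rw [hasDerivAt_iff_exists_continuousAt_slope] at *
  obtain ⟨p, hp, rfl, hf⟩ := hf
  obtain ⟨q, hq, rfl, hg⟩ := hg
  -- Splitting `f g - f x g x = f x (g - g x) + (f - f x) g` leaves `g t` in the slope, hence the
  -- continuity of `g` recorded above.
  refine ⟨fun t => f x • q t + p t • g t, (continuousAt_const.smul hq).add (hp.smul hgc), rfl,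
    fun t => ?_⟩
  nth_rw 1 [hf t]
  rw [add_smul, smul_add, smul_smul, smul_smul, smul_eq_mul]
  nth_rw 1 [hg t]
  rw [smul_add, smul_smul, mul_comm (f x)]; abel

theorem hasDerivAt_const_curve (y : E) (x : ℝ) : HasDerivAt (fun _ : ℝ => y) 0 x :=
  hasDerivAt_iff_exists_continuousAt_slope.2 ⟨fun _ => 0, continuousAt_const, rfl, by simp⟩

theorem hasDerivAt_smul_const {f : ℝ → ℝ} {y : ℝ} {x : ℝ} (hf : HasDerivAt f y x) (z : E) :
    HasDerivAt (fun t => f t • z) (y • z) x := by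
  simpa using hasDerivAt_smul hf (hasDerivAt_const_curve z x)

theorem hasDerivAt_sum {ι : Type*} (s : Finset ι) {f : ι → ℝ → E} {y : ι → E} {x : ℝ}
    (h : ∀ i ∈ s, HasDerivAt (f i) (y i) x) :
    HasDerivAt (fun t => ∑ i ∈ s, f i t) (∑ i ∈ s, y i) x := by
  classical
  induction s using Finset.induction_on with
  | empty => simpa using hasDerivAt_const_curve (0 : E) x
  | insert a s ha ih =>
    simp only [Finset.sum_insert ha]
    exact hasDerivAt_add (h a (Finset.mem_insert_self a s))
      (ih fun i hi => h i (Finset.mem_insert_of_mem hi))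

theorem hasDerivAt_comp {f : ℝ → E} {φ : ℝ → ℝ} {y : E} {z : ℝ} {x : ℝ}
    (hf : HasDerivAt f y (φ x)) (hφ : HasDerivAt φ z x) :
    HasDerivAt (fun t => f (φ t)) (z • y) x := by
  have hc := hφ.continuousAt
  rw [hasDerivAt_iff_exists_continuousAt_slope] at *
  obtain ⟨p, hp, rfl, hf⟩ := hf
  obtain ⟨q, hq, rfl, hφ⟩ := hφ
  refine ⟨fun t => q t • p (φ t), hq.smul (hp.comp hc), rfl, fun t => ?_⟩
  have h1 : φ t - φ x = (t - x) * q t := by rw [hφ t, smul_eq_mul]; ring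
  rw [hf (φ t), h1, smul_smul]

theorem hasDerivAt_clm_comp (L : E →L[ℝ] F) {f : ℝ → E} {y : E} {x : ℝ}
    (hf : HasDerivAt f y x) : HasDerivAt (fun t => L (f t)) (L y) x := by
  rw [hasDerivAt_iff_exists_continuousAt_slope] at *
  obtain ⟨p, hp, rfl, hf⟩ := hf
  refine ⟨fun t => L (p t), L.continuous.continuousAt.comp hp, rfl, fun t => ?_⟩
  rw [hf t, map_add, map_smul]

theorem hasDerivAt_prodMk {f : ℝ → E} {g : ℝ → F} {y : E} {z : F} {x : ℝ}
    (hf : HasDerivAt f y x) (hg : HasDerivAt g z x) :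
    HasDerivAt (fun t => (f t, g t)) (y, z) x := by
  rw [hasDerivAt_iff_exists_continuousAt_slope] at *
  obtain ⟨p, hp, rfl, hf⟩ := hf
  obtain ⟨q, hq, rfl, hg⟩ := hg
  exact ⟨fun t => (p t, q t), hp.prodMk hq, rfl, fun t => by rw [hf t, hg t]; rfl⟩

/-- Curves with `k` continuous derivatives. -/
def CurveCk : ℕ → (ℝ → E) → Prop
  | 0, c => Continuous c
  | k + 1, c => ∃ c' : ℝ → E, (∀ t, HasDerivAt c (c' t) t) ∧ CurveCk k c'

theorem CurveCk.continuous {k : ℕ} {c : ℝ → E} (h : CurveCk k c) : Continuous c := by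
  cases k with
  | zero => exact h
  | succ k =>
    obtain ⟨c', hc, -⟩ := h
    exact continuous_iff_continuousAt.2 fun t => continuousAt_of_hasDerivAt (hc t)

theorem CurveCk.of_succ {k : ℕ} {c : ℝ → E} (h : CurveCk (k + 1) c) : CurveCk k c := by
  induction k generalizing c with
  | zero => exact h.continuous
  | succ k ih =>
    obtain ⟨c', hc, h'⟩ := h
    exact ⟨c', hc, ih h'⟩

theorem CurveCk.add {k : ℕ} {c d : ℝ → E} (hc : CurveCk k c) (hd : CurveCk k d) :
    CurveCk k (fun t => c t + d t) := by
  induction k generalizing c d with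
  | zero => exact Continuous.add hc hd
  | succ k ih =>
    obtain ⟨c', hc, hc'⟩ := hc
    obtain ⟨d', hd, hd'⟩ := hd
    exact ⟨_, fun t => hasDerivAt_add (hc t) (hd t), ih hc' hd'⟩

theorem curveCk_const (k : ℕ) (y : E) : CurveCk k (fun _ : ℝ => y) := by
  induction k generalizing y with
  | zero => exact continuous_const
  | succ k ih => exact ⟨fun _ => 0, fun t => hasDerivAt_const_curve y t, ih 0⟩

theorem CurveCk.smul {k : ℕ} {φ : ℝ → ℝ} {c : ℝ → E} (hφ : CurveCk k φ) (hc : CurveCk k c) :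
    CurveCk k (fun t => φ t • c t) := by
  induction k generalizing φ c with
  | zero => exact Continuous.smul hφ hc
  | succ k ih =>
    have hφ0 := hφ.of_succ
    have hc0 := hc.of_succ
    obtain ⟨φ', hφ, hφ'⟩ := hφ
    obtain ⟨c', hc, hc'⟩ := hc
    exact ⟨_, fun t => hasDerivAt_smul (hφ t) (hc t), (ih hφ0 hc').add (ih hφ' hc0)⟩

theorem CurveCk.comp {k : ℕ} {φ : ℝ → ℝ} {c : ℝ → E} (hφ : CurveCk k φ) (hc : CurveCk k c) :
    CurveCk k (fun t => c (φ t)) := by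
  induction k generalizing c with
  | zero => exact Continuous.comp hc hφ
  | succ k ih =>
    have hφ0 := hφ.of_succ
    obtain ⟨φ', hφ, hφ'⟩ := hφ
    obtain ⟨c', hc, hc'⟩ := hc
    exact ⟨_, fun t => hasDerivAt_comp (hc (φ t)) (hφ t), hφ'.smul (ih hφ0 hc')⟩

theorem CurveCk.clm_comp {k : ℕ} (L : E →L[ℝ] F) {c : ℝ → E} (hc : CurveCk k c) :
    CurveCk k (fun t => L (c t)) := by
  induction k generalizing c with
  | zero => exact L.continuous.comp hc
  | succ k ih =>
    obtain ⟨c', hc, hc'⟩ := hc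
    exact ⟨_, fun t => hasDerivAt_clm_comp L (hc t), ih hc'⟩

theorem CurveCk.prodMk {k : ℕ} {c : ℝ → E} {d : ℝ → F} (hc : CurveCk k c) (hd : CurveCk k d) :
    CurveCk k (fun t => (c t, d t)) := by
  induction k generalizing c d with
  | zero => exact Continuous.prodMk hc hd
  | succ k ih =>
    obtain ⟨c', hc, hc'⟩ := hc
    obtain ⟨d', hd, hd'⟩ := hd
    exact ⟨_, fun t => hasDerivAt_prodMk (hc t) (hd t), ih hc' hd'⟩

theorem curveCk_of_contDiff {k : ℕ} {φ : ℝ → ℝ} (hφ : ContDiff ℝ k φ) : CurveCk k φ := by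
  induction k generalizing φ with
  | zero => exact hφ.continuous
  | succ k ih =>
    have h := contDiff_succ_iff_deriv.1 (by exact_mod_cast hφ : ContDiff ℝ ((k : ℕ) + 1) φ)
    exact ⟨deriv φ, fun t => (h.1 t).hasDerivAt, ih h.2.2⟩

theorem _root_.IsSmoothCurve.curveCk {c : ℝ → E} (h : IsSmoothCurve c) (k : ℕ) :
    CurveCk k c := by
  obtain ⟨d, rfl, hd⟩ := h
  have key : ∀ k n, CurveCk k (d n) := by
    intro k
    induction k with
    | zero => exact fun n => (hd n).1
    | succ k ih => exact fun n => ⟨d (n + 1), (hd n).2, ih (n + 1)⟩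
  exact key k 0

section T2

variable [T2Space E]

/-- In a Hausdorff space derivatives are unique, so `deriv c` is the canonical witness. This lets
the separate `C^k` statements be assembled into the single sequence `deriv^[n] c`. -/
theorem curveCk_succ_iff {k : ℕ} {c : ℝ → E} :
    CurveCk (k + 1) c ↔ (∀ t, HasDerivAt c (deriv c t) t) ∧ CurveCk k (deriv c) := by
  constructor
  · rintro ⟨c', hc, hc'⟩
    have : deriv c = c' := funext fun t => deriv_eq_of_hasDerivAt (hc t)
    rw [this]; exact ⟨hc, hc'⟩
  · exact fun h => ⟨_, h⟩

theorem CurveCk.iterate_deriv {k n : ℕ} {c : ℝ → E} (h : CurveCk (k + n) c) :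
    CurveCk k (deriv^[n] c) := by
  induction n generalizing c with
  | zero => exact h
  | succ n ih => exact ih (curveCk_succ_iff.1 h).2

theorem isSmoothCurve_iff {c : ℝ → E} : IsSmoothCurve c ↔ ∀ k, CurveCk k c := by
  refine ⟨fun h => h.curveCk, fun h => ⟨fun n => deriv^[n] c, rfl, fun n => ⟨?_, fun t => ?_⟩⟩⟩
  · exact (CurveCk.iterate_deriv (k := 0) (h _)).continuous
  · change HasDerivAt (deriv^[n] c) (deriv^[n + 1] c t) t
    rw [Function.iterate_succ_apply']
    exact (curveCk_succ_iff.1 (CurveCk.iterate_deriv (k := 1) (n := n) (h _))).1 t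

theorem _root_.IsSmoothCurve.hasDerivAt_iterate_deriv {c : ℝ → E} (h : IsSmoothCurve c) (n : ℕ)
    (t : ℝ) : HasDerivAt (deriv^[n] c) (deriv^[n + 1] c t) t := by
  rw [Function.iterate_succ_apply']
  exact (curveCk_succ_iff.1 (CurveCk.iterate_deriv (k := 1) (n := n) (h.curveCk _))).1 t

theorem _root_.IsSmoothCurve.continuous_iterate_deriv {c : ℝ → E} (h : IsSmoothCurve c) (n : ℕ) :
    Continuous (deriv^[n] c) :=
  (CurveCk.iterate_deriv (k := 0) (h.curveCk _)).continuous

theorem eventuallyEq_deriv {c d : ℝ → E} {t : ℝ} (h : c =ᶠ[𝓝 t] d) :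
    deriv c =ᶠ[𝓝 t] deriv d := by
  filter_upwards [Filter.EventuallyEq.fderiv (𝕜 := ℝ) h] with s hs
  simp [deriv, hs]

theorem eventuallyEq_iterate_deriv {c d : ℝ → E} {t : ℝ} (h : c =ᶠ[𝓝 t] d) (n : ℕ) :
    deriv^[n] c =ᶠ[𝓝 t] deriv^[n] d := by
  induction n generalizing c d with
  | zero => exact h
  | succ n ih => exact ih (eventuallyEq_deriv h)

theorem curveCk_of_locally {k : ℕ} {c : ℝ → E}
    (h : ∀ t, ∃ w : ℝ → E, CurveCk k w ∧ c =ᶠ[𝓝 t] w) : CurveCk k c := by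
  induction k generalizing c with
  | zero =>
    refine continuous_iff_continuousAt.2 fun t => ?_
    obtain ⟨w, hw, hcw⟩ := h t
    exact (CurveCk.continuous hw).continuousAt.congr hcw.symm
  | succ k ih =>
    refine curveCk_succ_iff.2 ⟨fun t => ?_, ih fun t => ?_⟩
    · obtain ⟨w, hw, hcw⟩ := h t
      rw [(eventuallyEq_deriv hcw).eq_of_nhds]
      exact hasDerivAt_congr ((curveCk_succ_iff.1 hw).1 t) hcw
    · obtain ⟨w, hw, hcw⟩ := h t
      exact ⟨deriv w, (curveCk_succ_iff.1 hw).2, eventuallyEq_deriv hcw⟩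

theorem isSmoothCurve_of_locally {c : ℝ → E}
    (h : ∀ t, ∃ w : ℝ → E, IsSmoothCurve w ∧ c =ᶠ[𝓝 t] w) : IsSmoothCurve c :=
  isSmoothCurve_iff.2 fun k => curveCk_of_locally fun t =>
    let ⟨w, hw, hcw⟩ := h t
    ⟨w, hw.curveCk k, hcw⟩

theorem _root_.IsSmoothCurve.add {c d : ℝ → E} (hc : IsSmoothCurve c) (hd : IsSmoothCurve d) :
    IsSmoothCurve (fun t => c t + d t) :=
  isSmoothCurve_iff.2 fun k => (hc.curveCk k).add (hd.curveCk k)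

theorem isSmoothCurve_const (y : E) : IsSmoothCurve (fun _ : ℝ => y) :=
  isSmoothCurve_iff.2 fun k => curveCk_const k y

theorem _root_.IsSmoothCurve.smul {φ : ℝ → ℝ} {c : ℝ → E} (hφ : IsSmoothCurve φ)
    (hc : IsSmoothCurve c) : IsSmoothCurve (fun t => φ t • c t) :=
  isSmoothCurve_iff.2 fun k => (hφ.curveCk k).smul (hc.curveCk k)

theorem _root_.IsSmoothCurve.comp {φ : ℝ → ℝ} {c : ℝ → E} (hc : IsSmoothCurve c)
    (hφ : IsSmoothCurve φ) : IsSmoothCurve (fun t => c (φ t)) :=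
  isSmoothCurve_iff.2 fun k => (hφ.curveCk k).comp (hc.curveCk k)

theorem _root_.IsSmoothCurve.clm_comp [T2Space F] {c : ℝ → E} (hc : IsSmoothCurve c)
    (L : E →L[ℝ] F) : IsSmoothCurve (fun t => L (c t)) :=
  isSmoothCurve_iff.2 fun k => (hc.curveCk k).clm_comp L

theorem _root_.IsSmoothCurve.prodMk [T2Space F] {c : ℝ → E} {d : ℝ → F} (hc : IsSmoothCurve c)
    (hd : IsSmoothCurve d) : IsSmoothCurve (fun t => (c t, d t)) :=
  isSmoothCurve_iff.2 fun k => (hc.curveCk k).prodMk (hd.curveCk k)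

theorem isSmoothCurve_of_contDiff {φ : ℝ → ℝ} (hφ : ∀ n : ℕ, ContDiff ℝ n φ) :
    IsSmoothCurve φ :=
  isSmoothCurve_iff.2 fun k => curveCk_of_contDiff (hφ k)

theorem isSmoothCurve_line (x v : E) : IsSmoothCurve (fun t : ℝ => x + t • v) :=
  (isSmoothCurve_const x).add
    ((isSmoothCurve_of_contDiff fun _ => contDiff_id).smul (isSmoothCurve_const v))

/-- Iterated derivatives of an affine reparametrization of a smooth curve. -/
theorem _root_.IsSmoothCurve.iterate_deriv_comp_affine {c : ℝ → E} (hc : IsSmoothCurve c)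
    (a r : ℝ) (n : ℕ) (t : ℝ) :
    deriv^[n] (fun s => c (a + r * s)) t = r ^ n • deriv^[n] c (a + r * t) := by
  induction n generalizing t with
  | zero => simp
  | succ n ih =>
    rw [Function.iterate_succ_apply', funext ih]
    refine deriv_eq_of_hasDerivAt ?_
    have h1 : HasDerivAt (fun s : ℝ => a + r * s) r t := by
      simpa using ((hasDerivAt_id t).const_mul r).const_add a
    have h2 := hasDerivAt_smul (hasDerivAt_const t (r ^ n))
      (hasDerivAt_comp (hc.hasDerivAt_iterate_deriv n (a + r * t)) h1)
    rw [zero_smul, add_zero, smul_smul, ← pow_succ] at h2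
    exact h2

end T2

end Calculus

/-! ### Dyadic block sums and the curve lemma -/

section CurveLemma

/-- Smooth real functions with compact support in the open interval `(1/2, 1)`. -/
structure IsBlockBump (ψ : ℝ → ℝ) : Prop where
  contDiff : ∀ n : ℕ, ContDiff ℝ n ψ
  tsupport_subset : tsupport ψ ⊆ Ioo (1 / 2) 1

theorem IsBlockBump.deriv {ψ : ℝ → ℝ} (h : IsBlockBump ψ) : IsBlockBump (deriv ψ) where
  contDiff n := (contDiff_succ_iff_deriv.1
    (by exact_mod_cast h.contDiff (n + 1) : ContDiff ℝ ((n : ℕ) + 1) ψ)).2.2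
  tsupport_subset :=
    (closure_minimal support_deriv_subset (isClosed_tsupport ψ)).trans h.tsupport_subset

theorem IsBlockBump.iterate_deriv {ψ : ℝ → ℝ} (h : IsBlockBump ψ) (n : ℕ) :
    IsBlockBump (_root_.deriv^[n] ψ) := by
  induction n with
  | zero => exact h
  | succ n ih => rw [Function.iterate_succ_apply']; exact ih.deriv

theorem IsBlockBump.eq_zero {ψ : ℝ → ℝ} (h : IsBlockBump ψ) {t : ℝ} (ht : t ∉ Ioo (1 / 2 : ℝ) 1) :
    ψ t = 0 :=
  image_eq_zero_of_notMem_tsupport fun h' => ht (h.tsupport_subset h')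

theorem IsBlockBump.hasDerivAt {ψ : ℝ → ℝ} (h : IsBlockBump ψ) (t : ℝ) :
    HasDerivAt ψ (_root_.deriv ψ t) t :=
  ((h.contDiff 1).differentiable (by simp) t).hasDerivAt

theorem IsBlockBump.exists_bound {ψ : ℝ → ℝ} (h : IsBlockBump ψ) :
    ∃ M : ℝ, 0 < M ∧ ∀ t, |ψ t| ≤ M := by
  have hcs : HasCompactSupport ψ := by
    refine HasCompactSupport.intro (isCompact_Icc (a := (1 / 2 : ℝ)) (b := 1)) fun t ht => ?_
    exact h.eq_zero fun h' => ht (Ioo_subset_Icc_self h')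
  obtain ⟨C, hC⟩ := hcs.exists_bound_of_continuous (h.contDiff 0).continuous
  exact ⟨max C 1, by positivity, fun t => (hC t).trans (le_max_left _ _)⟩

variable {E : Type*} [AddCommGroup E] [Module ℝ E] [TopologicalSpace E]
  [IsTopologicalAddGroup E] [ContinuousSMul ℝ E]

/-- The sum `∑ ψ (2ⁿ t) b n`, whose terms have pairwise disjoint supports when `ψ` is supported
in `(1/2, 1)`. -/
noncomputable def blockSum (ψ : ℝ → ℝ) (b : ℕ → E) (t : ℝ) : E :=
  ∑ᶠ n : ℕ, ψ (2 ^ n * t) • b n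

/-- The dyadic intervals `2⁻ⁿ (1/2, 1)` are disjoint. -/
theorem block_index_unique {t : ℝ} {m n : ℕ} (hm : (2 : ℝ) ^ m * t ∈ Ioo (1 / 2 : ℝ) 1)
    (hn : (2 : ℝ) ^ n * t ∈ Ioo (1 / 2 : ℝ) 1) : m = n := by
  have key : ∀ {m n : ℕ}, (2 : ℝ) ^ m * t ∈ Ioo (1 / 2 : ℝ) 1 →
      (2 : ℝ) ^ n * t ∈ Ioo (1 / 2 : ℝ) 1 → ¬ m < n := by
    intro m n hm hn hlt
    obtain ⟨k, rfl⟩ := Nat.exists_eq_add_of_lt hlt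
    have h1 : (2 : ℝ) ^ (m + k + 1) * t = 2 ^ k * (2 * (2 ^ m * t)) := by ring
    have h2 : (1 : ℝ) ≤ 2 ^ k := one_le_pow₀ (by norm_num)
    rw [h1] at hn
    nlinarith [hm.1, hn.2]
  exact le_antisymm (not_lt.1 (key hn hm)) (not_lt.1 (key hm hn))

theorem blockSum_eq_of_mem {ψ : ℝ → ℝ} (h : IsBlockBump ψ) (b : ℕ → E) {t : ℝ} {n : ℕ}
    (hn : (2 : ℝ) ^ n * t ∈ Ioo (1 / 2 : ℝ) 1) : blockSum ψ b t = ψ (2 ^ n * t) • b n := by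
  refine finsum_eq_single _ n fun m hm => ?_
  rw [h.eq_zero fun h' => hm (block_index_unique h' hn), zero_smul]

theorem blockSum_eq_zero {ψ : ℝ → ℝ} (h : IsBlockBump ψ) (b : ℕ → E) {t : ℝ}
    (ht : ∀ n : ℕ, (2 : ℝ) ^ n * t ∉ Ioo (1 / 2 : ℝ) 1) : blockSum ψ b t = 0 := by
  rw [blockSum, ← finsum_zero (α := ℕ)]
  exact finsum_congr fun n => by rw [h.eq_zero (ht n), zero_smul]

theorem blockSum_of_nonpos {ψ : ℝ → ℝ} (h : IsBlockBump ψ) (b : ℕ → E) {t : ℝ} (ht : t ≤ 0) :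
    blockSum ψ b t = 0 := by
  refine blockSum_eq_zero h b fun n hn => ?_
  have : (2 : ℝ) ^ n * t ≤ 0 := mul_nonpos_of_nonneg_of_nonpos (by positivity) ht
  linarith [hn.1]

/-- The blocks shrink towards `0`: those with index at least `N` lie to the left of `a`. Hence
smoothness is in question only at `0`. -/
theorem blockSum_eq_sum {ψ : ℝ → ℝ} (h : IsBlockBump ψ) (b : ℕ → E) {a t : ℝ} {N : ℕ}
    (ha : 1 ≤ 2 ^ N * a) (ht : a < t) (ha0 : 0 < a) :
    blockSum ψ b t = ∑ n ∈ Finset.range N, ψ (2 ^ n * t) • b n := by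
  refine finsum_eq_sum_of_support_subset _ fun n hn => ?_
  simp only [Finset.coe_range, mem_Iio]
  by_contra hN
  refine hn ?_
  have h1 : (2 : ℝ) ^ N ≤ 2 ^ n := pow_le_pow_right₀ (by norm_num) (not_lt.1 hN)
  have h2 : (1 : ℝ) ≤ 2 ^ n * t := ha.trans (mul_le_mul h1 ht.le ha0.le (by positivity))
  change ψ (2 ^ n * t) • b n = 0
  rw [h.eq_zero fun h' => absurd h'.2 (not_lt.2 h2), zero_smul]

/-- Sequences converging to zero faster than any power of `2⁻ⁿ`. -/
def RapidlyDecreasing (b : ℕ → E) : Prop :=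
  ∀ j : ℕ, Tendsto (fun n : ℕ => (2 : ℝ) ^ (n * j) • b n) atTop (𝓝 0)

/-- Differentiation replaces `(ψ, b)` by `(ψ', 2ⁿ b n)`, which is again a block sum, so the result
can be iterated. At `0`, a point `t` of the `n`-th block has `t⁻¹ < 2 * 2ⁿ`, so the difference
quotient is controlled by `2ⁿ b n`. -/
theorem hasDerivAt_blockSum {ψ : ℝ → ℝ} (h : IsBlockBump ψ) {b : ℕ → E}
    (hb : Tendsto (fun n : ℕ => (2 : ℝ) ^ n • b n) atTop (𝓝 0)) (t : ℝ) :
    HasDerivAt (blockSum ψ b) (blockSum (deriv ψ) (fun n => (2 : ℝ) ^ n • b n) t) t := by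
  rcases lt_trichotomy t 0 with ht | rfl | ht
  · rw [blockSum_of_nonpos h.deriv _ ht.le]
    refine hasDerivAt_congr (hasDerivAt_const_curve (0 : E) t) ?_
    filter_upwards [Iio_mem_nhds ht] with s hs
    exact blockSum_of_nonpos h b (le_of_lt hs)
  · rw [blockSum_of_nonpos h.deriv _ le_rfl, hasDerivAt_iff_tendsto_slope_zero_right,
      blockSum_of_nonpos h b le_rfl]
    simp only [zero_add, sub_zero]
    refine Tendsto.mono_left ?_ (nhdsWithin_le_nhds (s := {0}ᶜ))
    obtain ⟨M, hM0, hM⟩ := h.exists_bound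
    refine (nhds_basis_balanced ℝ E).tendsto_right_iff.2 fun V hV => ?_
    have h1 : Tendsto (fun n : ℕ => (2 * M) • (2 : ℝ) ^ n • b n) atTop (𝓝 0) := by
      simpa using hb.const_smul (2 * M)
    obtain ⟨N, hN⟩ := eventually_atTop.1 (h1.eventually_mem hV.1)
    -- Below this bound `t` can meet only blocks with index at least `N`.
    filter_upwards [Iio_mem_nhds (by positivity : (0 : ℝ) < (2 ^ (N + 1))⁻¹)] with t ht
    by_cases hex : ∃ n : ℕ, (2 : ℝ) ^ n * t ∈ Ioo (1 / 2 : ℝ) 1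
    · obtain ⟨n, hn⟩ := hex
      rw [blockSum_eq_of_mem h b hn]
      have ht0 : 0 < t := by
        by_contra h0
        have : (2 : ℝ) ^ n * t ≤ 0 :=
          mul_nonpos_of_nonneg_of_nonpos (by positivity) (not_lt.1 h0)
        linarith [hn.1]
      have hNn : N ≤ n := by
        by_contra hlt
        have h2 : (2 : ℝ) ^ n ≤ 2 ^ N := pow_le_pow_right₀ (by norm_num) (not_le.1 hlt).le
        have h3 : (2 : ℝ) ^ n * t ≤ 2 ^ N * (2 ^ (N + 1))⁻¹ :=
          mul_le_mul h2 (le_of_lt ht) ht0.le (by positivity)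
        have h4 : (2 : ℝ) ^ N * (2 ^ (N + 1))⁻¹ = 1 / 2 := by
          rw [pow_succ]; field_simp
        linarith [hn.1]
      -- The quotient becomes a scalar of absolute value at most `1` times an element of the
      -- balanced set `V`.
      have hid : t⁻¹ • ψ (2 ^ n * t) • b n =
          (t⁻¹ * ψ (2 ^ n * t) * (2 * M * 2 ^ n)⁻¹) • ((2 * M) • (2 : ℝ) ^ n • b n) := by
        simp only [smul_smul]
        congr 1
        field_simp
      rw [hid]
      refine hV.2.smul_mem ?_ (hN n hNn)
      rw [Real.norm_eq_abs, abs_mul, abs_mul, abs_inv, abs_of_pos ht0,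
        abs_of_pos (by positivity : (0 : ℝ) < (2 * M * 2 ^ n)⁻¹)]
      have h5 : t⁻¹ ≤ 2 * 2 ^ n := by
        rw [inv_le_iff_one_le_mul₀ ht0]
        nlinarith [hn.1]
      calc t⁻¹ * |ψ (2 ^ n * t)| * (2 * M * 2 ^ n)⁻¹
          ≤ (2 * 2 ^ n) * M * (2 * M * 2 ^ n)⁻¹ := by
            gcongr
            exact hM _
        _ = 1 := by field_simp
    · rw [blockSum_eq_zero h b (not_exists.1 hex), smul_zero]
      exact mem_of_mem_nhds hV.1
  · obtain ⟨N, hN⟩ := pow_unbounded_of_one_lt (2 / t) (one_lt_two (α := ℝ))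
    have ha : 1 ≤ 2 ^ N * (t / 2) := by
      rw [div_lt_iff₀ ht] at hN; linarith
    rw [blockSum_eq_sum h.deriv _ ha (by linarith) (by linarith)]
    have h1 : HasDerivAt (fun s => ∑ n ∈ Finset.range N, ψ (2 ^ n * s) • b n)
        (∑ n ∈ Finset.range N, deriv ψ (2 ^ n * t) • (2 : ℝ) ^ n • b n) t := by
      refine hasDerivAt_sum _ fun n _ => ?_
      have h2 := (h.hasDerivAt (2 ^ n * t)).comp t ((hasDerivAt_id t).const_mul ((2 : ℝ) ^ n))
      have h3 := hasDerivAt_smul_const h2 (b n)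
      rw [mul_one, ← smul_smul] at h3
      exact h3
    refine hasDerivAt_congr h1 ?_
    filter_upwards [Ioi_mem_nhds (by linarith : t / 2 < t)] with s hs
    exact blockSum_eq_sum h b ha hs (by linarith)

theorem isSmoothCurve_blockSum {ψ : ℝ → ℝ} (h : IsBlockBump ψ) {b : ℕ → E}
    (hb : RapidlyDecreasing b) : IsSmoothCurve (blockSum ψ b) := by
  have key : ∀ j t, HasDerivAt (blockSum (deriv^[j] ψ) fun n => (2 : ℝ) ^ (n * j) • b n)
      (blockSum (deriv^[j + 1] ψ) (fun n => (2 : ℝ) ^ (n * (j + 1)) • b n) t) t := by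
    intro j t
    have h1 : (fun n : ℕ => (2 : ℝ) ^ (n * (j + 1)) • b n) =
        fun n => (2 : ℝ) ^ n • (2 : ℝ) ^ (n * j) • b n := by
      funext n; rw [smul_smul, ← pow_add]; congr 2; ring
    rw [Function.iterate_succ_apply', h1]
    refine hasDerivAt_blockSum (h.iterate_deriv j) ?_ t
    rw [← h1]; exact hb (j + 1)
  refine ⟨fun j => blockSum (deriv^[j] ψ) fun n => (2 : ℝ) ^ (n * j) • b n, ?_, fun j => ⟨?_, ?_⟩⟩
  · simp
  · exact continuous_iff_continuousAt.2 fun t => continuousAt_of_hasDerivAt (key j t)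
  · exact key j

/-- The factor `2^(-n²)` beats every `2^(n j)`: the product is at most `2⁻ⁿ` once `n ≥ j + 1`. -/
theorem rapidlyDecreasing_of_tendsto {a : ℕ → E} {y : E} (ha : Tendsto a atTop (𝓝 y)) :
    RapidlyDecreasing fun n => ((2 : ℝ) ^ (n ^ 2))⁻¹ • a n := by
  intro j
  have h1 : Tendsto (fun n : ℕ => (2 : ℝ) ^ (n * j) * ((2 : ℝ) ^ (n ^ 2))⁻¹) atTop (𝓝 0) := by
    have h2 : Tendsto (fun n : ℕ => ((1 : ℝ) / 2) ^ n) atTop (𝓝 0) :=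
      tendsto_pow_atTop_nhds_zero_of_lt_one (by norm_num) (by norm_num)
    refine squeeze_zero' (Eventually.of_forall fun n => by positivity) ?_ h2
    filter_upwards [eventually_ge_atTop (j + 1)] with n hn
    rw [one_div, inv_pow, ← div_eq_mul_inv, div_le_iff₀ (by positivity), ← div_eq_inv_mul,
      le_div_iff₀ (by positivity), ← pow_add]
    refine pow_le_pow_right₀ (by norm_num) ?_
    nlinarith
  have := h1.smul ha
  simpa [smul_smul] using this

theorem exists_isBlockBump : ∃ ψ : ℝ → ℝ, IsBlockBump ψ ∧ ∀ t, |t - 3 / 4| ≤ 1 / 8 → ψ t = 1 := by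
  -- Any outer radius between `1/8` and `1/4` keeps the support inside `(1/2, 1)`.
  let φ : ContDiffBump (3 / 4 : ℝ) := ⟨1 / 8, 3 / 16, by norm_num, by norm_num⟩
  refine ⟨φ, ⟨fun n => φ.contDiff, ?_⟩, fun t ht => ?_⟩
  · rw [φ.tsupport_eq, Real.closedBall_eq_Icc]
    intro t ht
    change t ∈ Icc ((3 : ℝ) / 4 - 3 / 16) (3 / 4 + 3 / 16) at ht
    exact ⟨by linarith [ht.1], by linarith [ht.2]⟩
  · exact φ.one_of_mem_closedBall (Metric.mem_closedBall.2 (by rwa [Real.dist_eq]))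

/-- The curve lemma: a smooth curve through `x` at time `0` which passes through `x + b n` at time
`3 / 4 * 2⁻ⁿ`, on a straight line with velocity `2ⁿ w n`. -/
theorem exists_isSmoothCurve_of_rapidlyDecreasing [T2Space E] (x : E) {b w : ℕ → E}
    (hb : RapidlyDecreasing b) (hw : RapidlyDecreasing w) :
    ∃ c : ℝ → E, IsSmoothCurve c ∧ c 0 = x ∧ ∀ n : ℕ, ∀ᶠ τ in 𝓝 (0 : ℝ),
      c (3 / 4 * (2 ^ n)⁻¹ + τ) = x + b n + (τ * 2 ^ n) • w n := by
  obtain ⟨ψ, hψ, hψ1⟩ := exists_isBlockBump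
  -- This bump is linear near `3/4`, so its block sum prescribes the velocities while the one built
  -- from `ψ` prescribes the positions.
  have hψ' : IsBlockBump fun t => (t - 3 / 4) * ψ t := by
    refine ⟨fun n => (contDiff_id.sub contDiff_const).mul (hψ.contDiff n), ?_⟩
    exact (tsupport_mul_subset_right (f := fun t : ℝ => t - 3 / 4) (g := ψ)).trans
      hψ.tsupport_subset
  refine ⟨fun t => x + blockSum ψ b t + blockSum (fun t => (t - 3 / 4) * ψ t) w t, ?_, ?_, ?_⟩
  · exact ((isSmoothCurve_const x).add (isSmoothCurve_blockSum hψ hb)).add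
      (isSmoothCurve_blockSum hψ' hw)
  · simp [blockSum_of_nonpos hψ, blockSum_of_nonpos hψ']
  · intro n
    have hpos : (0 : ℝ) < (2 ^ n)⁻¹ / 8 := by positivity
    filter_upwards [Metric.ball_mem_nhds (0 : ℝ) hpos] with τ hτ
    have h1 : (2 : ℝ) ^ n * (3 / 4 * (2 ^ n)⁻¹ + τ) = 3 / 4 + τ * 2 ^ n := by
      field_simp
    have h2 : |τ * 2 ^ n| < 1 / 8 := by
      rw [mem_ball_zero_iff, Real.norm_eq_abs] at hτ
      rw [abs_mul, abs_of_pos (by positivity : (0 : ℝ) < 2 ^ n)]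
      calc |τ| * 2 ^ n < (2 ^ n)⁻¹ / 8 * 2 ^ n := by gcongr
        _ = 1 / 8 := by field_simp
    have h3 : (2 : ℝ) ^ n * (3 / 4 * (2 ^ n)⁻¹ + τ) ∈ Ioo (1 / 2 : ℝ) 1 := by
      rw [h1]
      rw [abs_lt] at h2
      exact ⟨by linarith [h2.1], by linarith [h2.2]⟩
    have h4 : ψ (3 / 4 + τ * 2 ^ n) = 1 := hψ1 _ (by simpa using h2.le)
    rw [blockSum_eq_of_mem hψ b h3, blockSum_eq_of_mem hψ' w h3, h1, h4]
    simp

/-- A smooth function with values in `(-δ, δ)` which is the identity near zero. -/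
theorem exists_isSmoothCurve_cutoff {δ : ℝ} (hδ : 0 < δ) :
    ∃ φ : ℝ → ℝ, IsSmoothCurve φ ∧ (∀ t, |φ t| < δ) ∧ ∀ t, |t| ≤ δ / 2 → φ t = t := by
  let χ : ContDiffBump (0 : ℝ) := ⟨δ / 2, δ, by linarith, by linarith⟩
  refine ⟨fun t => t * χ t, isSmoothCurve_of_contDiff fun n => contDiff_id.mul χ.contDiff,
    fun t => ?_, fun t ht => ?_⟩
  · rw [abs_mul, abs_of_nonneg χ.nonneg]
    rcases lt_or_ge |t| δ with h | h
    · exact (mul_le_of_le_one_right (abs_nonneg t) χ.le_one).trans_lt h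
    · rw [χ.zero_of_le_dist (by simpa [Real.dist_eq] using h), mul_zero]; exact hδ
  · have h1 : χ t = 1 :=
      χ.one_of_mem_closedBall (Metric.mem_closedBall.2 (by rwa [Real.dist_eq, sub_zero]))
    change t * χ t = t
    rw [h1, mul_one]

/-- Reparametrizing by a cutoff of the time variable keeps the curve near `c t₀` without changing
its germ. Convenient smoothness on `U` can then be tested on curves that are in `U` only near `t₀`.
-/
theorem exists_isSmoothCurve_eventuallyEq [T2Space E] {U : Set E} (hU : IsOpen U) {c : ℝ → E}
    (hc : IsSmoothCurve c) {t₀ : ℝ} (h₀ : c t₀ ∈ U) :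
    ∃ d : ℝ → E, IsSmoothCurve d ∧ (∀ t, d t ∈ U) ∧ d =ᶠ[𝓝 t₀] c := by
  have hcont : ContinuousAt c t₀ := (hc.curveCk 0).continuous.continuousAt
  obtain ⟨δ, hδ, hδU⟩ := Metric.mem_nhds_iff.1 (hcont (hU.mem_nhds h₀))
  obtain ⟨φ, hφ, hφ1, hφ2⟩ := exists_isSmoothCurve_cutoff hδ
  refine ⟨fun t => c (t₀ + φ (t - t₀)), ?_, fun t => ?_, ?_⟩
  · have h1 : IsSmoothCurve fun t : ℝ => t - t₀ :=
      isSmoothCurve_of_contDiff fun _ => contDiff_id.sub contDiff_const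
    exact hc.comp ((isSmoothCurve_const t₀).add (hφ.comp h1))
  · refine hδU ?_
    simpa [Real.dist_eq] using hφ1 (t - t₀)
  · filter_upwards [Metric.ball_mem_nhds t₀ (half_pos hδ)] with t ht
    rw [hφ2 _ (by simpa [Real.dist_eq] using ht.le), add_sub_cancel]

end CurveLemma

/-! ### Openness and continuity detected along fast sequences -/

section FastSequences

variable {E : Type*} [AddCommGroup E] [Module ℝ E] [TopologicalSpace E]
  [IsTopologicalAddGroup E] [ContinuousSMul ℝ E]
variable {F : Type*} [AddCommGroup F] [Module ℝ F] [TopologicalSpace F]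
  [IsTopologicalAddGroup F] [ContinuousSMul ℝ F]

/-- With a countable base `V n` at `0`, choose the `n`-th point `y` so close to `x` that even
`2^(n²) (y - x)` lies in `V n`. -/
theorem exists_rapidlyDecreasing_of_frequently [FirstCountableTopology E] {x : E}
    {P : ℕ → E → Prop} (h : ∀ n, ∃ᶠ y in 𝓝 x, P n y) :
    ∃ b : ℕ → E, RapidlyDecreasing b ∧ ∀ n, P n (x + b n) := by
  obtain ⟨V, hV⟩ := (𝓝 (0 : E)).exists_antitone_basis
  have key : ∀ n, ∃ a ∈ V n, P n (x + ((2 : ℝ) ^ (n ^ 2))⁻¹ • a) := by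
    intro n
    have h1 : Tendsto (fun y : E => (2 : ℝ) ^ (n ^ 2) • (y - x)) (𝓝 x) (𝓝 0) := by
      have : Continuous fun y : E => (2 : ℝ) ^ (n ^ 2) • (y - x) :=
        (continuous_id.sub continuous_const).const_smul _
      simpa using this.tendsto x
    obtain ⟨y, hy, hyV⟩ := ((h n).and_eventually (h1.eventually_mem (hV.1.mem_of_mem trivial))).exists
    refine ⟨_, hyV, ?_⟩
    rwa [inv_smul_smul₀ (by positivity), add_sub_cancel]
  choose a ha hP using key
  exact ⟨_, rapidlyDecreasing_of_tendsto (hV.tendsto ha), hP⟩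

theorem rapidlyDecreasing_zero : RapidlyDecreasing (fun _ : ℕ => (0 : E)) := fun j => by
  simpa using tendsto_const_nhds

theorem tendsto_block_center :
    Tendsto (fun n : ℕ => (3 / 4 : ℝ) * (2 ^ n)⁻¹) atTop (𝓝 0) := by
  have h2 : Tendsto (fun n : ℕ => ((1 : ℝ) / 2) ^ n) atTop (𝓝 0) :=
    tendsto_pow_atTop_nhds_zero_of_lt_one (by norm_num) (by norm_num)
  simpa using h2.const_mul (3 / 4)

/-- Otherwise points outside `U` converge fast to some `x ∈ U`. A smooth curve through them meets
the complement of `U` at times tending to `0`, although its preimage of `U` is a neighbourhood of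
`0`. -/
theorem isOpen_of_isCInftyOpen [FirstCountableTopology E] [T2Space E] {U : Set E}
    (hU : IsCInftyOpen U) : IsOpen U := by
  refine isOpen_iff_mem_nhds.2 fun x hx => ?_
  by_contra hn
  obtain ⟨b, hb, hbU⟩ := exists_rapidlyDecreasing_of_frequently (x := x)
    (P := fun _ y => y ∉ U) fun _ h => hn (by simpa [Filter.Eventually] using h)
  obtain ⟨c, hc, hc0, hcn⟩ :=
    exists_isSmoothCurve_of_rapidlyDecreasing x hb rapidlyDecreasing_zero
  have h1 : c ⁻¹' U ∈ 𝓝 (0 : ℝ) := (hU c hc).mem_nhds (by rw [mem_preimage, hc0]; exact hx)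
  obtain ⟨n, hn⟩ := (tendsto_block_center.eventually_mem h1).exists
  have h2 := (hcn n).self_of_nhds
  rw [add_zero, zero_mul, zero_smul, add_zero] at h2
  rw [mem_preimage, h2] at hn
  exact hbU n hn

theorem _root_.ConvenientSmoothOn.continuousOn [FirstCountableTopology E] [T2Space E] [T2Space F]
    {f : E → F} {U : Set E} (hU : IsOpen U) (hf : ConvenientSmoothOn f U) :
    ContinuousOn f U := by
  intro x hx
  refine ContinuousAt.continuousWithinAt fun V hV => ?_
  by_contra hn
  obtain ⟨b, hb, hbU⟩ := exists_rapidlyDecreasing_of_frequently (x := x)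
    (P := fun _ y => f y ∉ V) fun _ h => hn (h.mono fun _ hy => not_not.1 hy)
  obtain ⟨c, hc, hc0, hcn⟩ :=
    exists_isSmoothCurve_of_rapidlyDecreasing x hb rapidlyDecreasing_zero
  obtain ⟨d, hd, hdU, hdc⟩ := exists_isSmoothCurve_eventuallyEq hU hc (t₀ := 0)
    (by rw [hc0]; exact hx)
  have h1 : ∀ᶠ t in 𝓝 (0 : ℝ), (f ∘ d) t ∈ V := by
    refine ((hf d hd hdU).curveCk 0).continuous.continuousAt.eventually_mem ?_
    rw [Function.comp, hdc.self_of_nhds, hc0]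
    exact hV
  obtain ⟨n, hn1, hn2⟩ := (tendsto_block_center.eventually (h1.and hdc)).exists
  have h2 := (hcn n).self_of_nhds
  rw [add_zero, zero_mul, zero_smul, add_zero] at h2
  rw [Function.comp, hn2, h2] at hn1
  exact hbU n hn1

end FastSequences

/-! ### Mean value theorem and chain rule in locally convex spaces -/

section MeanValue

variable {E : Type*} [AddCommGroup E] [Module ℝ E] [TopologicalSpace E]
  [IsTopologicalAddGroup E] [ContinuousSMul ℝ E]
variable {F : Type*} [AddCommGroup F] [Module ℝ F] [TopologicalSpace F]
  [IsTopologicalAddGroup F] [ContinuousSMul ℝ F] [LocallyConvexSpace ℝ F]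

/-- The mean value theorem for scalarwise differentiable curves. -/
theorem slope_mem_of_weak_deriv_mem {C : Set F} (hC : Convex ℝ C) (hC' : IsClosed C)
    {g g' : ℝ → F} {a b : ℝ} (hab : a ≠ b)
    (hg : ∀ l : StrongDual ℝ F, ∀ t ∈ uIcc a b, HasDerivAt (fun s => l (g s)) (l (g' t)) t)
    (hg' : ∀ t ∈ uIcc a b, g' t ∈ C) : (b - a)⁻¹ • (g b - g a) ∈ C := by
  wlog hlt : a < b generalizing a b
  · have h1 := this hab.symm (by rwa [uIcc_comm]) (by rwa [uIcc_comm])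
      (lt_of_le_of_ne (not_lt.1 hlt) hab.symm)
    rwa [← neg_sub b a, ← neg_sub (g b) (g a), inv_neg, neg_smul_neg] at h1
  rw [uIcc_of_le hlt.le] at hg hg'
  by_contra hn
  -- A functional separating the slope from `C` contradicts the scalar mean value theorem.
  obtain ⟨l, u, hl, hu⟩ := geometric_hahn_banach_closed_point hC hC' hn
  obtain ⟨ξ, hξ, h1⟩ := exists_hasDerivAt_eq_slope (fun s => l (g s)) (fun s => l (g' s)) hlt
    (fun t ht => (hg l t ht).continuousAt.continuousWithinAt)
    (fun t ht => hg l t (Ioo_subset_Icc_self ht))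
  have h2 := hl _ (hg' ξ (Ioo_subset_Icc_self hξ))
  rw [map_smul, map_sub, smul_eq_mul, ← div_eq_inv_mul, ← h1] at hu
  exact lt_irrefl _ (hu.trans h2)

theorem slope_mem_of_deriv_mem {C : Set F} (hC : Convex ℝ C) (hC' : IsClosed C)
    {g g' : ℝ → F} {a b : ℝ} (hab : a ≠ b) (hg : ∀ t ∈ uIcc a b, HasDerivAt g (g' t) t)
    (hg' : ∀ t ∈ uIcc a b, g' t ∈ C) : (b - a)⁻¹ • (g b - g a) ∈ C :=
  slope_mem_of_weak_deriv_mem hC hC' hab (fun l t ht => hasDerivAt_clm_comp l (hg t ht)) hg'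

theorem exists_convex_closed_nhds_subset {y : F} {V : Set F} (hV : V ∈ 𝓝 y) :
    ∃ C ∈ 𝓝 y, Convex ℝ C ∧ IsClosed C ∧ C ⊆ V := by
  obtain ⟨D, hD, hDc, hDV⟩ := exists_mem_nhds_isClosed_subset hV
  obtain ⟨C, ⟨hC, hCc⟩, hCD⟩ := (LocallyConvexSpace.convex_basis (𝕜 := ℝ) y).mem_iff.1 hD
  exact ⟨closure C, mem_of_superset hC subset_closure, hCc.closure, isClosed_closure,
    (closure_minimal hCD hDc).trans hDV⟩

/-- A curve whose scalarwise derivative is a continuous curve is differentiable. -/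
theorem hasDerivAt_of_weak {g g' : ℝ → F} {t₀ : ℝ}
    (hg : ∀ l : StrongDual ℝ F, ∀ t, HasDerivAt (fun s => l (g s)) (l (g' t)) t)
    (hg' : ContinuousAt g' t₀) : HasDerivAt g (g' t₀) t₀ := by
  rw [hasDerivAt_iff_tendsto_slope_zero_right]
  intro V hV
  obtain ⟨C, hC, hCc, hCcl, hCV⟩ := exists_convex_closed_nhds_subset hV
  obtain ⟨δ, hδ, hδC⟩ := Metric.mem_nhds_iff.1 (hg' hC)
  have h1 : Metric.ball (0 : ℝ) δ ∈ 𝓝[≠] 0 :=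
    mem_nhdsWithin_of_mem_nhds (Metric.ball_mem_nhds _ hδ)
  rw [mem_map]
  filter_upwards [h1, self_mem_nhdsWithin] with t ht ht0
  have ht0' : t ≠ 0 := ht0
  have h2 := slope_mem_of_weak_deriv_mem hCc hCcl (g := g) (g' := g') (a := t₀) (b := t₀ + t)
    (by simpa using ht0') (fun l s _ => hg l s) fun s hs => hδC ?_
  · rw [add_sub_cancel_left] at h2
    exact hCV h2
  · have h3 := abs_sub_left_of_mem_uIcc hs
    rw [add_sub_cancel_left] at h3
    rw [mem_ball_zero_iff, Real.norm_eq_abs] at ht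
    rw [Metric.mem_ball, Real.dist_eq]
    exact h3.trans_lt ht

theorem hasDerivAt_line_of_hasGateauxDerivAt {f : E → F} {y : F} {x h : E} {u : ℝ}
    (hf : HasGateauxDerivAt f y (x + u • h) h) : HasDerivAt (fun s : ℝ => f (x + s • h)) y u := by
  rw [hasDerivAt_iff_tendsto_slope_zero_right]
  refine Tendsto.congr (fun t => ?_) hf
  rw [add_smul, add_assoc]

/-- With the Carathéodory slope `q`, the point `c (t₀ + t)` is `c t₀ + t • q (t₀ + t)`. For fixed
`t` the increment of `f` is thus taken along a straight segment. The mean value theorem places its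
quotient in any closed convex set containing the values of `f'` on that segment, and joint
continuity of `f'` finishes. -/
theorem hasDerivAt_comp_of_hasGateauxDerivAt {f : E → F} {f' : E × E → F} {U : Set E}
    (hU : IsOpen U) (hf : ∀ x ∈ U, ∀ h, HasGateauxDerivAt f (f' (x, h)) x h)
    (hf' : ContinuousOn f' (U ×ˢ univ)) {c : ℝ → E} {v : E} {t₀ : ℝ} (hc : HasDerivAt c v t₀)
    (h₀ : c t₀ ∈ U) : HasDerivAt (fun t => f (c t)) (f' (c t₀, v)) t₀ := by
  obtain ⟨q, hq, rfl, hcq⟩ := hasDerivAt_iff_exists_continuousAt_slope.1 hc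
  rw [hasDerivAt_iff_tendsto_slope_zero_right]
  intro V hV
  obtain ⟨C, hC, hCc, hCcl, hCV⟩ := exists_convex_closed_nhds_subset hV
  have hUo : IsOpen (U ×ˢ (univ : Set E)) := hU.prod isOpen_univ
  have hmem : U ×ˢ (univ : Set E) ∈ 𝓝 (c t₀, q t₀) := hUo.mem_nhds ⟨h₀, mem_univ _⟩
  have hW : ∀ᶠ z in 𝓝 (c t₀, q t₀), z ∈ U ×ˢ (univ : Set E) ∧ f' z ∈ C :=
    Filter.Eventually.and hmem ((hf'.continuousAt hmem).eventually_mem hC)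
  have hq0 : ContinuousAt (fun p : ℝ × ℝ => q (t₀ + p.2)) (0, 0) := by
    refine ContinuousAt.comp (g := q) ?_ (by fun_prop)
    simpa using hq
  -- The position `s` on the segment and the time `t` fixing its direction are independent
  -- parameters.
  have hG : Tendsto (fun p : ℝ × ℝ => (c t₀ + p.1 • q (t₀ + p.2), q (t₀ + p.2))) (𝓝 (0, 0))
      (𝓝 (c t₀, q t₀)) := by
    have h2 : ContinuousAt
        (fun p : ℝ × ℝ => (c t₀ + p.1 • q (t₀ + p.2), q (t₀ + p.2))) (0, 0) :=
      (continuousAt_const.add (continuousAt_fst.smul hq0)).prodMk hq0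
    simpa [ContinuousAt] using h2
  obtain ⟨δ, hδ, hδW⟩ := Metric.eventually_nhds_iff.1 (hG.eventually hW)
  have h1 : Metric.ball (0 : ℝ) δ ∈ 𝓝[≠] 0 :=
    mem_nhdsWithin_of_mem_nhds (Metric.ball_mem_nhds _ hδ)
  rw [mem_map]
  filter_upwards [h1, self_mem_nhdsWithin] with t ht ht0
  have ht0' : t ≠ 0 := ht0
  rw [mem_ball_zero_iff, Real.norm_eq_abs] at ht
  have key : ∀ s ∈ uIcc 0 t, (c t₀ + s • q (t₀ + t) ∈ U) ∧
      f' (c t₀ + s • q (t₀ + t), q (t₀ + t)) ∈ C := by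
    intro s hs
    have h3 := abs_sub_left_of_mem_uIcc hs
    rw [sub_zero, sub_zero] at h3
    have h4 := @hδW (s, t) (by
      rw [Prod.dist_eq, max_lt_iff, Real.dist_eq, Real.dist_eq, sub_zero, sub_zero]
      exact ⟨h3.trans_lt ht, ht⟩)
    exact ⟨h4.1.1, h4.2⟩
  have h5 := slope_mem_of_deriv_mem hCc hCcl (g := fun s : ℝ => f (c t₀ + s • q (t₀ + t)))
    (g' := fun s => f' (c t₀ + s • q (t₀ + t), q (t₀ + t))) (a := 0) (b := t) ht0'.symm
    (fun s hs => hasDerivAt_line_of_hasGateauxDerivAt (hf _ (key s hs).1 _))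
    fun s hs => (key s hs).2
  have h6 : c (t₀ + t) = c t₀ + t • q (t₀ + t) := by
    rw [hcq (t₀ + t), add_sub_cancel_left]
  refine hCV ?_
  simpa [h6] using h5

end MeanValue

/-! ### Gâteaux smooth maps are convenient smooth -/

theorem _root_.GateauxCkOn.continuousOn {E : Type u} [AddCommGroup E] [Module ℝ E]
    [TopologicalSpace E] {F : Type v} [AddCommGroup F] [Module ℝ F] [TopologicalSpace F] {k : ℕ}
    {f : E → F} {U : Set E} (h : GateauxCkOn k f U) : ContinuousOn f U := by
  cases k with
  | zero => exact h
  | succ k => exact h.1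

theorem _root_.IsSmoothCurve.deriv {E : Type*} [AddCommGroup E] [Module ℝ E]
    [TopologicalSpace E] [IsTopologicalAddGroup E] [ContinuousSMul ℝ E] [T2Space E] {c : ℝ → E}
    (hc : IsSmoothCurve c) : IsSmoothCurve (deriv c) :=
  isSmoothCurve_iff.2 fun k => (curveCk_succ_iff.1 (hc.curveCk (k + 1))).2

/-- The chain rule turns `(f ∘ c)'` into `f' ∘ (c, c')`, a composite with a smooth curve in `U × E`.
The induction therefore has to vary the space `E`. -/
theorem _root_.GateauxCkOn.curveCk_comp {F : Type v} [AddCommGroup F] [Module ℝ F]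
    [TopologicalSpace F] [IsTopologicalAddGroup F] [ContinuousSMul ℝ F] [LocallyConvexSpace ℝ F]
    {k : ℕ} {E : Type u} [AddCommGroup E] [Module ℝ E]
    [TopologicalSpace E] [IsTopologicalAddGroup E] [ContinuousSMul ℝ E] [T2Space E]
    {f : E → F} {U : Set E} (hU : IsOpen U) (hf : GateauxCkOn k f U) {c : ℝ → E}
    (hc : IsSmoothCurve c) (hcU : ∀ t, c t ∈ U) : CurveCk k (fun t => f (c t)) := by
  induction k generalizing E with
  | zero => exact ContinuousOn.comp_continuous hf (hc.curveCk 0).continuous hcU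
  | succ k ih =>
    obtain ⟨-, f', hf, hf'⟩ := hf
    refine ⟨fun t => f' (c t, deriv c t), fun t => ?_,
      ih (hU.prod isOpen_univ) hf' (hc.prodMk hc.deriv) fun t => ⟨hcU t, mem_univ _⟩⟩
    exact hasDerivAt_comp_of_hasGateauxDerivAt hU hf hf'.continuousOn
      (hc.hasDerivAt_iterate_deriv 0 t) (hcU t)

theorem _root_.GateauxSmoothOn.convenientSmoothOn {F : Type v} [AddCommGroup F] [Module ℝ F]
    [TopologicalSpace F] [IsTopologicalAddGroup F] [ContinuousSMul ℝ F] [LocallyConvexSpace ℝ F]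
    [T2Space F] {E : Type u} [AddCommGroup E] [Module ℝ E]
    [TopologicalSpace E] [IsTopologicalAddGroup E] [ContinuousSMul ℝ E] [T2Space E]
    {f : E → F} {U : Set E} (hU : IsOpen U) (hf : GateauxSmoothOn f U) :
    ConvenientSmoothOn f U :=
  fun _ hc hcU => isSmoothCurve_iff.2 fun k => (hf k).curveCk_comp hU hc hcU

/-! ### Continuity of iterated directional derivatives -/

section DirectionalDerivatives

variable {E : Type*} [AddCommGroup E] [Module ℝ E] [TopologicalSpace E]
  [IsTopologicalAddGroup E] [ContinuousSMul ℝ E]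
variable {F : Type*} [AddCommGroup F] [Module ℝ F] [TopologicalSpace F]
  [IsTopologicalAddGroup F] [ContinuousSMul ℝ F]

/-- The `n`-th derivative of `g` at `x` along the line with direction `v`. -/
noncomputable def lineDerivIter (g : E → F) (v : E) (n : ℕ) (x : E) : F :=
  deriv^[n] (fun τ : ℝ => g (x + τ • v)) 0

variable [T2Space E] [T2Space F]

theorem lineDerivIter_zero (g : E → F) (v x : E) : lineDerivIter g v 0 x = g x := by
  simp [lineDerivIter]

theorem isSmoothCurve_comp_line {g : E → F} (hg : ConvenientSmoothOn g univ) (x v : E) :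
    IsSmoothCurve fun τ : ℝ => g (x + τ • v) :=
  hg _ (isSmoothCurve_line x v) fun _ => mem_univ _

theorem lineDerivIter_add_smul {g : E → F} (hg : ConvenientSmoothOn g univ) (v : E) (n : ℕ)
    (x : E) (τ : ℝ) :
    lineDerivIter g v n (x + τ • v) = deriv^[n] (fun σ : ℝ => g (x + σ • v)) τ := by
  have h := (isSmoothCurve_comp_line hg x v).iterate_deriv_comp_affine τ 1 n 0
  rw [one_pow, one_smul, mul_zero, add_zero] at h
  rw [lineDerivIter, ← h]
  simp only [one_mul, add_smul, add_assoc]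

theorem hasDerivAt_lineDerivIter {g : E → F} (hg : ConvenientSmoothOn g univ) (v : E) (n : ℕ)
    (x : E) (τ : ℝ) : HasDerivAt (fun σ : ℝ => lineDerivIter g v n (x + σ • v))
      (lineDerivIter g v (n + 1) (x + τ • v)) τ := by
  rw [lineDerivIter_add_smul hg, funext (lineDerivIter_add_smul hg v n x)]
  exact (isSmoothCurve_comp_line hg x v).hasDerivAt_iterate_deriv n τ

/-- Otherwise pick points `x + b m` tending fast to `x` where the derivative is too large, and a
smooth curve crossing them along direction `v`. The `n`-th derivatives of `g ∘ c` at the crossing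
times converge by continuity, so after division by `m + 1` they tend to `0`, against the choice of
the points. -/
theorem lineDerivIter_locally_bounded [FirstCountableTopology E] {g : E → F}
    (hg : ConvenientSmoothOn g univ) (v : E) (n : ℕ) (x : E) {V : Set F} (hV : V ∈ 𝓝 (0 : F)) :
    ∃ A : ℝ, 0 < A ∧ ∀ᶠ y in 𝓝 x, A • lineDerivIter g v n y ∈ V := by
  by_contra! hn
  -- The speed of the curve at the `m`-th crossing: `2^m` from the block scaling and `2^(-m²)` from
  -- making the velocities decrease rapidly. An `n`-th derivative picks up `σ m ^ n`.
  let σ : ℕ → ℝ := fun m => 2 ^ m * (2 ^ (m ^ 2))⁻¹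
  have hσ : ∀ m, 0 < σ m := fun m => by positivity
  obtain ⟨b, hb, hbV⟩ := exists_rapidlyDecreasing_of_frequently (x := x)
    (P := fun m y => ((m + 1 : ℝ)⁻¹ * σ m ^ n) • lineDerivIter g v n y ∉ V)
    fun m => hn _ (by have := hσ m; positivity)
  obtain ⟨c, hc, hc0, hcn⟩ := exists_isSmoothCurve_of_rapidlyDecreasing x hb
    (rapidlyDecreasing_of_tendsto (tendsto_const_nhds (x := v)))
  have hgc : IsSmoothCurve (fun t => g (c t)) := hg c hc fun _ => mem_univ _
  have key : ∀ m : ℕ, deriv^[n] (fun t => g (c t)) (3 / 4 * (2 ^ m)⁻¹) =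
      σ m ^ n • lineDerivIter g v n (x + b m) := by
    intro m
    have h1 := hgc.iterate_deriv_comp_affine (3 / 4 * (2 ^ m)⁻¹) 1 n 0
    have h2 := (isSmoothCurve_comp_line hg (x + b m) v).iterate_deriv_comp_affine 0 (σ m) n 0
    simp only [one_mul, mul_zero, add_zero, zero_add, one_pow, one_smul] at h1 h2
    rw [← h1, lineDerivIter, ← h2]
    refine (eventuallyEq_iterate_deriv ?_ n).eq_of_nhds
    filter_upwards [hcn m] with τ hτ
    rw [hτ, smul_smul]
    congr 3
    simp only [σ]; ring
  have h3 : Tendsto (fun m : ℕ => (m + 1 : ℝ)⁻¹ •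
      deriv^[n] (fun t => g (c t)) (3 / 4 * (2 ^ m)⁻¹)) atTop (𝓝 0) := by
    have h4 : Tendsto (fun m : ℕ => (m + 1 : ℝ)⁻¹) atTop (𝓝 0) := by
      simpa using tendsto_one_div_add_atTop_nhds_zero_nat (𝕜 := ℝ)
    have h5 := h4.smul (((hgc.continuous_iterate_deriv n).tendsto 0).comp tendsto_block_center)
    rw [zero_smul] at h5
    exact h5
  obtain ⟨m, hm⟩ := (h3.eventually_mem hV).exists
  rw [key, smul_smul] at hm
  exact hbV m hm

section Seminorm

variable [LocallyConvexSpace ℝ F]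

/-- A first-order Taylor estimate from two applications of the mean value theorem to closed
`p`-balls: first to `w'`, then to `w s - s • w' 0`. -/
theorem seminorm_slope_sub_deriv_le {p : Seminorm ℝ F} (hp : Continuous p) {w w' w'' : ℝ → F}
    {R t : ℝ} (ht : 0 < t) (hw : ∀ s, HasDerivAt w (w' s) s) (hw' : ∀ s, HasDerivAt w' (w'' s) s)
    (hR : ∀ s ∈ Icc 0 t, p (w'' s) ≤ R) : p (t⁻¹ • (w t - w 0) - w' 0) ≤ R * t := by
  have hconv : ∀ r : ℝ, Convex ℝ {y | p y ≤ r} := fun r => by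
    simpa [Seminorm.closedBall] using p.convex_closedBall 0 r
  have hcl : ∀ r : ℝ, IsClosed {y | p y ≤ r} := fun r => isClosed_le hp continuous_const
  have hR0 : 0 ≤ R := (apply_nonneg p _).trans (hR 0 ⟨le_rfl, ht.le⟩)
  have h1 : ∀ s ∈ Icc 0 t, p (w' s - w' 0) ≤ R * t := by
    intro s hs
    rcases hs.1.eq_or_lt with rfl | hs0
    · simpa using mul_nonneg hR0 ht.le
    · have h2 := slope_mem_of_deriv_mem (hconv R) (hcl R) hs0.ne (fun r _ => hw' r)
        fun r hr => hR r (by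
          rw [uIcc_of_le hs0.le] at hr
          exact ⟨hr.1, hr.2.trans hs.2⟩)
      rw [mem_ofPred_eq, sub_zero, map_smul_eq_mul, norm_inv, Real.norm_of_nonneg hs0.le,
        inv_mul_le_iff₀ hs0] at h2
      nlinarith [hs.2]
  have h3 : ∀ s, HasDerivAt (fun s => w s + s • (-w' 0)) (w' s + (1 : ℝ) • (-w' 0)) s :=
    fun s => hasDerivAt_add (hw s) (hasDerivAt_smul_const (hasDerivAt_id s) _)
  have h4 := slope_mem_of_deriv_mem (hconv (R * t)) (hcl (R * t)) ht.ne (fun s _ => h3 s)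
    fun s hs => by
      rw [uIcc_of_le ht.le] at hs
      rw [mem_ofPred_eq, one_smul, ← sub_eq_add_neg]
      exact h1 s hs
  have h5 : (t - 0)⁻¹ • (w t + t • (-w' 0) - (w 0 + (0 : ℝ) • (-w' 0))) =
      t⁻¹ • (w t - w 0) - w' 0 := by
    rw [sub_zero, zero_smul, add_zero, smul_neg, ← sub_eq_add_neg, sub_right_comm,
      smul_sub _ _ (t • w' 0), inv_smul_smul₀ ht.ne']
  rw [h5] at h4
  exact h4

/-- The difference quotients of the `n`-th derivative are continuous by induction. They approximate
the next derivative locally uniformly, because the one after that is locally bounded. -/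
theorem continuous_lineDerivIter [FirstCountableTopology E] {g : E → F}
    (hg : ConvenientSmoothOn g univ) (v : E) (n : ℕ) : Continuous (lineDerivIter g v n) := by
  induction n with
  | zero =>
    rw [funext (lineDerivIter_zero g v)]
    exact continuousOn_univ.1 (hg.continuousOn isOpen_univ)
  | succ n ih =>
    refine continuous_iff_continuousAt.2 fun x => ?_
    have hws := with_gaugeSeminormFamily (𝕜 := ℝ) (E := F)
    refine (hws.tendsto_nhds _ _).2 fun s ε hε => ?_
    set p : Seminorm ℝ F := gaugeSeminormFamily ℝ F s
    have hp : Continuous p := hws.continuous_seminorm s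
    have hball : p.ball 0 1 ∈ 𝓝 (0 : F) := by
      simpa [Seminorm.ball_zero_eq] using
        (isOpen_lt hp continuous_const).mem_nhds (by simp : p (0 : F) < 1)
    obtain ⟨A, hA, hAb⟩ := lineDerivIter_locally_bounded hg v (n + 2) x hball
    have hG : Tendsto (fun z : E × ℝ => z.1 + z.2 • v) (𝓝 x ×ˢ 𝓝 0) (𝓝 x) := by
      have h1 : Continuous fun z : E × ℝ => z.1 + z.2 • v :=
        continuous_fst.add (continuous_snd.smul continuous_const)
      have h2 := h1.tendsto (x, 0)
      rwa [nhds_prod_eq, zero_smul, add_zero] at h2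
    obtain ⟨P, hP, Q, hQ, hPQ⟩ := eventually_prod_iff.1 (hG.eventually hAb)
    obtain ⟨δ, hδ, hδQ⟩ := Metric.eventually_nhds_iff.1 hQ
    -- `t < δ` keeps the segment where the bound `A⁻¹` holds; `t < ε / 3 * A` makes the Taylor error
    -- `A⁻¹ * t` less than `ε / 3`.
    obtain ⟨t, ht0, htδ⟩ : ∃ t : ℝ, 0 < t ∧ t < min δ (ε / 3 * A) :=
      exists_between (lt_min hδ (by positivity))
    have htδ' := lt_min_iff.1 htδ
    have key : ∀ y, P y → p (t⁻¹ • (lineDerivIter g v n (y + t • v) - lineDerivIter g v n y) -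
        lineDerivIter g v (n + 1) y) < ε / 3 := by
      intro y hy
      have h1 := seminorm_slope_sub_deriv_le hp (R := A⁻¹) ht0
        (fun s => hasDerivAt_lineDerivIter hg v n y s)
        (fun s => hasDerivAt_lineDerivIter hg v (n + 1) y s) fun s hs => by
          have h2 := hPQ hy (hδQ (y := s) (by
            rw [Real.dist_eq, sub_zero, abs_of_nonneg hs.1]
            exact hs.2.trans_lt htδ'.1))
          rw [Seminorm.mem_ball_zero, map_smul_eq_mul, Real.norm_of_nonneg hA.le] at h2
          rw [← one_div, le_div_iff₀ hA, mul_comm]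
          exact h2.le
      simp only [zero_smul, add_zero] at h1
      refine h1.trans_lt ?_
      rw [inv_mul_lt_iff₀ hA, mul_comm]
      exact htδ'.2
    have hQc : Continuous fun y => t⁻¹ • (lineDerivIter g v n (y + t • v) -
        lineDerivIter g v n y) :=
      ((ih.comp (continuous_id.add continuous_const)).sub ih).const_smul _
    have h6 : ∀ᶠ y in 𝓝 x, p (t⁻¹ • (lineDerivIter g v n (y + t • v) - lineDerivIter g v n y) -
        t⁻¹ • (lineDerivIter g v n (x + t • v) - lineDerivIter g v n x)) < ε / 3 :=
      (hws.tendsto_nhds _ _).1 (hQc.tendsto x) s (ε / 3) (by positivity)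
    filter_upwards [hP, h6] with y hy hy6
    have k1 := key y hy
    have k2 := key x hP.self_of_nhds
    set Qy := t⁻¹ • (lineDerivIter g v n (y + t • v) - lineDerivIter g v n y)
    set Qx := t⁻¹ • (lineDerivIter g v n (x + t • v) - lineDerivIter g v n x)
    have h7 : lineDerivIter g v (n + 1) y - lineDerivIter g v (n + 1) x =
        (Qx - lineDerivIter g v (n + 1) x) + ((Qy - Qx) - (Qy - lineDerivIter g v (n + 1) y)) := by
      abel
    rw [h7]
    have h8 := map_add_le_add p (Qx - lineDerivIter g v (n + 1) x)
      ((Qy - Qx) - (Qy - lineDerivIter g v (n + 1) y))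
    have h9 := map_sub_le_add p (Qy - Qx) (Qy - lineDerivIter g v (n + 1) y)
    linarith

end Seminorm

end DirectionalDerivatives

/-! ### Mixed partial derivatives as combinations of directional ones -/

section Polarization

/-- Lagrange interpolation at `0, …, n + 1` is exact up to degree `n + 1`, so the linear coefficient
is a combination of values at the nodes. The factor `(n + 1)⁻¹` is there to cancel the binomial
coefficient in the polarization identity. -/
theorem exists_coeff_one_weights (n : ℕ) : ∃ a : ℕ → ℝ, ∀ m ≤ n + 1,
    ∑ i ∈ Finset.range (n + 2), a i * (i : ℝ) ^ m = if m = 1 then ((n : ℝ) + 1)⁻¹ else 0 := by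
  classical
  let L : ℕ → Polynomial ℝ := Lagrange.basis (Finset.range (n + 2)) (fun i : ℕ => (i : ℝ))
  refine ⟨fun i => ((n : ℝ) + 1)⁻¹ * (L i).coeff 1, fun m hm => ?_⟩
  have h1 := Lagrange.eq_interpolate (s := Finset.range (n + 2)) (v := fun i : ℕ => (i : ℝ))
    (f := Polynomial.X ^ m) (fun i _ j _ hij => Nat.cast_injective hij) (by
      rw [Polynomial.degree_X_pow, Finset.card_range]
      exact_mod_cast Nat.lt_succ_of_le hm)
  have h2 := congrArg (fun p : Polynomial ℝ => p.coeff 1) h1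
  simp only [Lagrange.interpolate_apply, Polynomial.finsetSum_coeff, Polynomial.coeff_C_mul,
    Polynomial.eval_pow, Polynomial.eval_X, Polynomial.coeff_X_pow] at h2
  have h3 : ∑ i ∈ Finset.range (n + 2), ((n : ℝ) + 1)⁻¹ * (L i).coeff 1 * (i : ℝ) ^ m =
      ((n : ℝ) + 1)⁻¹ * ∑ i ∈ Finset.range (n + 2), (i : ℝ) ^ m * (L i).coeff 1 := by
    rw [Finset.mul_sum]
    exact Finset.sum_congr rfl fun i _ => by ring
  rw [h3, ← h2]
  by_cases hm1 : m = 1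
  · simp [hm1]
  · simp [hm1, Ne.symm hm1]

/-- Weights `a i`, `i ≤ n + 1`, with `∑ a i (i A + B) ^ (n + 1) = A B ^ n` for commuting
operators `A`, `B`. -/
noncomputable def polarWeight (n : ℕ) : ℕ → ℝ := (exists_coeff_one_weights n).choose

theorem sum_polarWeight_mul_pow (n m : ℕ) (hm : m ≤ n + 1) :
    ∑ i ∈ Finset.range (n + 2), polarWeight n i * (i : ℝ) ^ m =
      if m = 1 then ((n : ℝ) + 1)⁻¹ else 0 :=
  (exists_coeff_one_weights n).choose_spec m hm

theorem sum_polarWeight_smul_pow {R : Type*} [Ring R] [Algebra ℝ R] {A B : R} (h : Commute A B)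
    (n : ℕ) : ∑ i ∈ Finset.range (n + 2), polarWeight n i • ((i : ℝ) • A + B) ^ (n + 1) =
      A * B ^ n := by
  have h1 : ∀ i : ℕ, polarWeight n i • ((i : ℝ) • A + B) ^ (n + 1) =
      ∑ m ∈ Finset.range (n + 2), (polarWeight n i * (i : ℝ) ^ m) •
        (A ^ m * B ^ (n + 1 - m) * ((n + 1).choose m : R)) := by
    intro i
    rw [(h.smul_left (i : ℝ)).add_pow, Finset.smul_sum]
    refine Finset.sum_congr rfl fun m _ => ?_
    rw [smul_pow, smul_mul_assoc, smul_mul_assoc, smul_smul]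
  rw [Finset.sum_congr rfl fun i _ => h1 i, Finset.sum_comm]
  simp only [← Finset.sum_smul]
  rw [Finset.sum_eq_single 1]
  · rw [sum_polarWeight_mul_pow n 1 (by omega), if_pos rfl, pow_one, Nat.add_sub_cancel,
      Nat.choose_one_right, ← nsmul_eq_mul', ← Nat.cast_smul_eq_nsmul ℝ, smul_smul]
    push_cast
    rw [inv_mul_cancel₀ (by positivity), one_smul]
  · intro m hm hm1
    rw [sum_polarWeight_mul_pow n m (by have := Finset.mem_range.1 hm; omega), if_neg hm1, zero_smul]
  · intro h1
    exact absurd (Finset.mem_range.2 (by omega)) h1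

/-- Smooth real functions on the plane. -/
def smoothPlane : Submodule ℝ (ℝ × ℝ → ℝ) where
  carrier := {f | ContDiff ℝ (⊤ : ℕ∞) f}
  add_mem' hf hg := mem_ofPred.2 (ContDiff.add (mem_ofPred.1 hf) (mem_ofPred.1 hg))
  zero_mem' := mem_ofPred.2 contDiff_const
  smul_mem' _ _ hf := mem_ofPred.2 (contDiff_const.smul (mem_ofPred.1 hf))

theorem mem_smoothPlane {f : ℝ × ℝ → ℝ} : f ∈ smoothPlane ↔ ContDiff ℝ (⊤ : ℕ∞) f :=
  mem_ofPred

theorem smoothPlane_differentiable (f : smoothPlane) : Differentiable ℝ f.1 :=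
  ContDiff.differentiable (n := (⊤ : ℕ∞)) (mem_smoothPlane.1 f.2) (by simp)

theorem smoothPlane_contDiff_fderiv (f : smoothPlane) (v : ℝ × ℝ) :
    ContDiff ℝ (⊤ : ℕ∞) fun x => fderiv ℝ f.1 x v :=
  (ContDiff.fderiv_right (m := (⊤ : ℕ∞)) (n := (⊤ : ℕ∞)) (mem_smoothPlane.1 f.2) (by simp)).clm_apply contDiff_const

/-- The directional derivative as an operator on smooth functions. -/
noncomputable def planeDeriv (v : ℝ × ℝ) : Module.End ℝ smoothPlane where
  toFun f := ⟨fun x => fderiv ℝ f.1 x v, mem_smoothPlane.2 (smoothPlane_contDiff_fderiv f v)⟩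
  map_add' f g := by
    ext x
    change fderiv ℝ (f.1 + g.1) x v = fderiv ℝ f.1 x v + fderiv ℝ g.1 x v
    rw [fderiv_add (smoothPlane_differentiable f x) (smoothPlane_differentiable g x)]
    rfl
  map_smul' r f := by
    ext x
    change fderiv ℝ (r • f.1) x v = r • fderiv ℝ f.1 x v
    rw [fderiv_const_smul (smoothPlane_differentiable f x)]
    rfl

theorem planeDeriv_apply (v : ℝ × ℝ) (f : smoothPlane) (x : ℝ × ℝ) :
    (planeDeriv v f).1 x = fderiv ℝ f.1 x v := rfl

theorem planeDeriv_commute (v w : ℝ × ℝ) : Commute (planeDeriv v) (planeDeriv w) := by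
  refine LinearMap.ext fun f => ?_
  ext x
  have hd : DifferentiableAt ℝ (fderiv ℝ f.1) x :=
    (ContDiff.fderiv_right (m := (⊤ : ℕ∞)) (n := (⊤ : ℕ∞)) (mem_smoothPlane.1 f.2) (by simp)).differentiable
      (by simp) x
  have key : ∀ v w : ℝ × ℝ, (planeDeriv v (planeDeriv w f)).1 x =
      fderiv ℝ (fderiv ℝ f.1) x v w := by
    intro v w
    rw [planeDeriv_apply]
    change fderiv ℝ (fun y => fderiv ℝ f.1 y w) x v = _
    have h1 := hd.hasFDerivAt.clm_apply (hasFDerivAt_const w x)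
    rw [h1.fderiv]
    simp
  change (planeDeriv v (planeDeriv w f)).1 x = (planeDeriv w (planeDeriv v f)).1 x
  rw [key, key]
  exact second_derivative_symmetric (fun y => (smoothPlane_differentiable f y).hasFDerivAt)
    hd.hasFDerivAt v w

theorem planeDeriv_add_smul (r : ℝ) :
    planeDeriv (r, 1) = r • planeDeriv (1, 0) + planeDeriv (0, 1) := by
  refine LinearMap.ext fun f => ?_
  ext x
  change fderiv ℝ f.1 x (r, 1) = r • fderiv ℝ f.1 x (1, 0) + fderiv ℝ f.1 x (0, 1)
  rw [← map_smul, ← map_add]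
  simp

theorem hasDerivAt_planeDeriv (f : smoothPlane) (x v : ℝ × ℝ) :
    HasDerivAt (fun τ : ℝ => f.1 (x + τ • v)) ((planeDeriv v f).1 x) 0 := by
  have h1 : HasDerivAt (fun τ : ℝ => x + τ • v) v 0 := by
    simpa using ((hasDerivAt_id (0 : ℝ)).smul_const v).const_add x
  have h2 : HasFDerivAt f.1 (fderiv ℝ f.1 x) (x + (0 : ℝ) • v) := by
    simpa using (smoothPlane_differentiable f x).hasFDerivAt
  exact h2.comp_hasDerivAt (0 : ℝ) h1

theorem hasDerivAt_planeDeriv_fst (f : smoothPlane) (s t : ℝ) :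
    HasDerivAt (fun s => f.1 (s, t)) ((planeDeriv (1, 0) f).1 (s, t)) s :=
  (smoothPlane_differentiable f (s, t)).hasFDerivAt.comp_hasDerivAt s
    ((hasDerivAt_id s).prodMk (hasDerivAt_const s t))

theorem hasDerivAt_planeDeriv_snd (f : smoothPlane) (s t : ℝ) :
    HasDerivAt (fun t => f.1 (s, t)) ((planeDeriv (0, 1) f).1 (s, t)) t :=
  (smoothPlane_differentiable f (s, t)).hasFDerivAt.comp_hasDerivAt t
    ((hasDerivAt_const t s).prodMk (hasDerivAt_id t))

/-- The polarization formula for mixed partial derivatives. -/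
theorem sum_polarWeight_planeDeriv (n : ℕ) :
    ∑ i ∈ Finset.range (n + 2), polarWeight n i • planeDeriv ((i : ℝ), 1) ^ (n + 1) =
      planeDeriv (1, 0) * planeDeriv (0, 1) ^ n := by
  have h := sum_polarWeight_smul_pow (R := Module.End ℝ smoothPlane)
    (planeDeriv_commute (1, 0) (0, 1)) n
  have h1 : ∀ i : ℕ, (i : ℝ) • planeDeriv (1, 0) + planeDeriv (0, 1) = planeDeriv ((i : ℝ), 1) :=
    fun i => (planeDeriv_add_smul i).symm
  simp only [h1] at h
  exact h

end Polarization

/-! ### Mollification and limits of derivatives -/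

section Mollification

open MeasureTheory

/-- A sequence of mollifiers on the plane. -/
noncomputable def planeBump (n : ℕ) : ContDiffBump (0 : ℝ × ℝ) :=
  ⟨((n : ℝ) + 1)⁻¹ / 2, ((n : ℝ) + 1)⁻¹, by positivity, half_lt_self (by positivity)⟩

/-- Mollification of functions on the plane. -/
noncomputable def mollify (n : ℕ) (f : ℝ × ℝ → ℝ) : ℝ × ℝ → ℝ :=
  convolution ((planeBump n).normed volume) f (ContinuousLinearMap.lsmul ℝ ℝ) volume

theorem contDiff_mollify (n : ℕ) {f : ℝ × ℝ → ℝ} (hf : Continuous f) :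
    ContDiff ℝ (⊤ : ℕ∞) (mollify n f) :=
  (planeBump n).hasCompactSupport_normed.contDiff_convolution_left _
    (planeBump n).contDiff_normed hf.locallyIntegrable

theorem tendsto_mollify {f : ℝ × ℝ → ℝ} (hf : Continuous f) (x : ℝ × ℝ) :
    Tendsto (fun p : ℕ × (ℝ × ℝ) => mollify p.1 f p.2) (atTop ×ˢ 𝓝 x) (𝓝 (f x)) := by
  refine ContDiffBump.convolution_tendsto_right (φ := fun p : ℕ × (ℝ × ℝ) => planeBump p.1)
    (g := fun _ => f) (k := fun p => p.2) ?_
    (Eventually.of_forall fun _ => hf.aestronglyMeasurable) ((hf.tendsto x).comp tendsto_snd)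
    tendsto_snd
  have h1 : Tendsto (fun n : ℕ => ((n : ℝ) + 1)⁻¹) atTop (𝓝 0) := by
    simpa using tendsto_one_div_add_atTop_nhds_zero_nat (𝕜 := ℝ)
  exact h1.comp tendsto_fst

theorem tendsto_mollify_const {f : ℝ × ℝ → ℝ} (hf : Continuous f) (x : ℝ × ℝ) :
    Tendsto (fun n : ℕ => mollify n f x) atTop (𝓝 (f x)) :=
  Tendsto.comp (g := fun p : ℕ × (ℝ × ℝ) => mollify p.1 f p.2) (f := fun n => (n, x))
    (tendsto_mollify hf x) (tendsto_id.prodMk tendsto_const_nhds)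

/-- Mollification as a map into the smooth functions. -/
noncomputable def mollified (n : ℕ) (f : ℝ × ℝ → ℝ) (hf : Continuous f) : smoothPlane :=
  ⟨mollify n f, mem_smoothPlane.2 (contDiff_mollify n hf)⟩

/-- Differentiation under the integral sign needs a derivative of `f` in the single direction `v`
only, so mollification applies before any joint differentiability is known. -/
theorem hasDerivAt_mollify (n : ℕ) {f f' : ℝ × ℝ → ℝ} (hf : Continuous f) (hf' : Continuous f')
    (v x : ℝ × ℝ)
    (h : ∀ (y : ℝ × ℝ) (τ : ℝ), HasDerivAt (fun τ : ℝ => f (y + τ • v)) (f' (y + τ • v)) τ) :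
    HasDerivAt (fun τ : ℝ => mollify n f (x + τ • v)) (mollify n f' x) 0 := by
  set ρ := (planeBump n).normed (volume : Measure (ℝ × ℝ))
  have hρ : Continuous ρ := (planeBump n).continuous_normed
  have hρs : HasCompactSupport ρ := (planeBump n).hasCompactSupport_normed
  have hint : ∀ {u : ℝ × ℝ → ℝ}, Continuous u → ∀ z, Integrable (fun y => ρ y * u (z - y)) := by
    intro u hu z
    exact (hρ.mul (hu.comp (continuous_const.sub continuous_id))).integrable_of_hasCompactSupport
      hρs.mul_right
  -- The dominating constant comes from compactness of the support of `ρ` times `[-1, 1]`; off the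
  -- support the integrand vanishes.
  obtain ⟨C, hC⟩ : ∃ C, ∀ p ∈ tsupport ρ ×ˢ Icc (-1 : ℝ) 1, ‖f' (x - p.1 + p.2 • v)‖ ≤ C :=
    (hρs.isCompact.prod isCompact_Icc).exists_bound_of_continuousOn
      (f := fun p : (ℝ × ℝ) × ℝ => f' (x - p.1 + p.2 • v)) (by fun_prop)
  have key := hasDerivAt_integral_of_dominated_loc_of_deriv_le
    (μ := (volume : Measure (ℝ × ℝ))) (x₀ := (0 : ℝ)) (s := Icc (-1) 1)
    (F := fun τ y => ρ y * f (x + τ • v - y)) (F' := fun τ y => ρ y * f' (x - y + τ • v))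
    (bound := fun y => ‖ρ y‖ * C)
    (Icc_mem_nhds (by norm_num) (by norm_num))
    (Eventually.of_forall fun τ => (hint hf _).aestronglyMeasurable) (hint hf _)
    (by simpa using (hint hf' x).aestronglyMeasurable)
    (Eventually.of_forall fun y τ hτ => ?_)
    ((hρ.integrable_of_hasCompactSupport hρs).norm.mul_const C)
    (Eventually.of_forall fun y τ hτ => ?_)
  · simpa [mollify, convolution, ρ] using key.2
  · rw [norm_mul]
    by_cases hy : y ∈ tsupport ρ
    · exact mul_le_mul_of_nonneg_left (hC (y, τ) ⟨hy, hτ⟩) (norm_nonneg _)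
    · simp [image_eq_zero_of_notMem_tsupport hy]
  · have h1 := (h (x - y) τ).const_mul (ρ y)
    refine h1.congr_of_eventuallyEq (Eventually.of_forall fun σ => ?_)
    change ρ y * f (x + σ • v - y) = ρ y * f (x - y + σ • v)
    rw [add_sub_right_comm]

/-- Locally uniform limits of derivatives are derivatives of the limit. -/
theorem hasDerivAt_of_tendsto_nhds {w w' : ℕ → ℝ → ℝ} {g g' : ℝ → ℝ}
    (hw : ∀ n t, HasDerivAt (w n) (w' n t) t)
    (hg : ∀ t, Tendsto (fun n => w n t) atTop (𝓝 (g t))) (hg'c : Continuous g')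
    (hg' : ∀ t, Tendsto (fun p : ℕ × ℝ => w' p.1 p.2) (atTop ×ˢ 𝓝 t) (𝓝 (g' t))) (t : ℝ) :
    HasDerivAt g (g' t) t := by
  refine hasDerivAt_of_tendstoUniformlyOnFilter (l := atTop) (f := w) (f' := w') ?_
    (Eventually.of_forall fun p => hw p.1 p.2) (Eventually.of_forall hg)
  rw [tendstoUniformlyOnFilter_iff_tendsto]
  exact (((hg'c.tendsto t).comp tendsto_snd).prodMk_nhds (hg' t)).mono_right
    (nhds_le_uniformity _)

end Mollification

/-! ### Boman's theorem in the plane -/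

section Boman

/-- The candidate for the mixed partial derivative `∂₁ ∂₂ⁿ`, given the iterated directional
derivatives `D m i` in the directions `(i, 1)`. -/
noncomputable def mixedPartial {F : Type*} [AddCommGroup F] [Module ℝ F]
    (D : ℕ → ℕ → ℝ × ℝ → F) (n : ℕ) (x : ℝ × ℝ) : F :=
  ∑ i ∈ Finset.range (n + 2), polarWeight n i • D (n + 1) i x

section Scalar

variable {g : ℝ × ℝ → ℝ} {D : ℕ → ℕ → ℝ × ℝ → ℝ}

theorem planeDeriv_pow_mollify (hDc : ∀ n i, Continuous (D n i))
    (hD : ∀ (n i : ℕ) (x : ℝ × ℝ) (τ : ℝ), HasDerivAt (fun τ : ℝ => D n i (x + τ • ((i : ℝ), 1)))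
      (D (n + 1) i (x + τ • ((i : ℝ), 1))) τ) (hg : Continuous g) (hD0 : ∀ i, D 0 i = g)
    (N n i : ℕ) :
    ((planeDeriv ((i : ℝ), 1) ^ n) (mollified N g hg)).1 =
      mollify N (D n i) := by
  induction n with
  | zero => rw [hD0]; rfl
  | succ n ih =>
    rw [pow_succ', Module.End.mul_apply]
    funext x
    refine (hasDerivAt_planeDeriv _ x _).unique ?_
    rw [ih]
    exact hasDerivAt_mollify N (hDc n i) (hDc (n + 1) i) _ x (hD n i)

/-- Mollifications are smooth, so for them polarization is an identity between commuting operators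
and the candidate is the true mixed derivative. -/
theorem mixedPartial_mollify (hDc : ∀ n i, Continuous (D n i))
    (hD : ∀ (n i : ℕ) (x : ℝ × ℝ) (τ : ℝ), HasDerivAt (fun τ : ℝ => D n i (x + τ • ((i : ℝ), 1)))
      (D (n + 1) i (x + τ • ((i : ℝ), 1))) τ) (hg : Continuous g) (hD0 : ∀ i, D 0 i = g)
    (N n : ℕ) :
    mixedPartial (fun n i => mollify N (D n i)) n =
      ((planeDeriv (1, 0) * planeDeriv (0, 1) ^ n)
        (mollified N g hg)).1 := by
  rw [← sum_polarWeight_planeDeriv, LinearMap.sum_apply]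
  funext x
  rw [Submodule.coe_sum, Finset.sum_apply]
  refine Finset.sum_congr rfl fun i _ => ?_
  change polarWeight n i • mollify N (D (n + 1) i) x =
    polarWeight n i • ((planeDeriv ((i : ℝ), 1) ^ (n + 1)) (mollified N g hg)).1 x
  rw [planeDeriv_pow_mollify hDc hD hg hD0]

theorem tendsto_mixedPartial_mollify (hDc : ∀ n i, Continuous (D n i)) (n : ℕ) (x : ℝ × ℝ) :
    Tendsto (fun p : ℕ × (ℝ × ℝ) => mixedPartial (fun n i => mollify p.1 (D n i)) n p.2)
      (atTop ×ˢ 𝓝 x) (𝓝 (mixedPartial D n x)) :=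
  tendsto_finsetSum _ fun i _ => (tendsto_mollify (hDc (n + 1) i) x).const_smul _

theorem tendsto_mixedPartial_mollify_const (hDc : ∀ n i, Continuous (D n i)) (n : ℕ)
    (x : ℝ × ℝ) : Tendsto (fun N : ℕ => mixedPartial (fun n i => mollify N (D n i)) n x)
      atTop (𝓝 (mixedPartial D n x)) :=
  tendsto_finsetSum _ fun i _ => (tendsto_mollify_const (hDc (n + 1) i) x).const_smul _

theorem continuous_mixedPartial {F : Type*} [AddCommGroup F] [Module ℝ F] [TopologicalSpace F]
    [IsTopologicalAddGroup F] [ContinuousSMul ℝ F] {D : ℕ → ℕ → ℝ × ℝ → F}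
    (hDc : ∀ n i, Continuous (D n i)) (n : ℕ) : Continuous (mixedPartial D n) :=
  continuous_finsetSum _ fun i _ => (hDc (n + 1) i).const_smul _

/-- The identity for mollifications survives the limit because the mollified candidates converge
locally uniformly. -/
theorem hasDerivAt_mixedPartial_zero (hDc : ∀ n i, Continuous (D n i))
    (hD : ∀ (n i : ℕ) (x : ℝ × ℝ) (τ : ℝ), HasDerivAt (fun τ : ℝ => D n i (x + τ • ((i : ℝ), 1)))
      (D (n + 1) i (x + τ • ((i : ℝ), 1))) τ) (hg : Continuous g) (hD0 : ∀ i, D 0 i = g)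
    (s t : ℝ) : HasDerivAt (fun s => g (s, t)) (mixedPartial D 0 (s, t)) s := by
  have hline : ∀ s : ℝ, Tendsto (fun p : ℕ × ℝ => (p.1, (p.2, t))) (atTop ×ˢ 𝓝 s)
      (atTop ×ˢ 𝓝 (s, t)) := fun s =>
    tendsto_fst.prodMk ((Continuous.prodMk_left t).continuousAt.tendsto.comp tendsto_snd)
  refine hasDerivAt_of_tendsto_nhds (w := fun N s => mollify N g (s, t))
    (w' := fun N s => mixedPartial (fun n i => mollify N (D n i)) 0 (s, t))
    (g' := fun s => mixedPartial D 0 (s, t)) (fun N s => ?_) (fun s => ?_)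
    ((continuous_mixedPartial hDc 0).comp (Continuous.prodMk_left t)) (fun s => ?_) s
  · rw [mixedPartial_mollify hDc hD hg hD0, pow_zero, mul_one]
    exact hasDerivAt_planeDeriv_fst (mollified N g hg) s t
  · exact tendsto_mollify_const hg (s, t)
  · have h1 := Tendsto.comp (g := fun p : ℕ × (ℝ × ℝ) =>
      mixedPartial (fun n i => mollify p.1 (D n i)) 0 p.2)
      (tendsto_mixedPartial_mollify hDc 0 (s, t)) (hline s)
    exact h1

theorem hasDerivAt_mixedPartial (hDc : ∀ n i, Continuous (D n i))
    (hD : ∀ (n i : ℕ) (x : ℝ × ℝ) (τ : ℝ), HasDerivAt (fun τ : ℝ => D n i (x + τ • ((i : ℝ), 1)))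
      (D (n + 1) i (x + τ • ((i : ℝ), 1))) τ) (hg : Continuous g) (hD0 : ∀ i, D 0 i = g)
    (n : ℕ) (s t : ℝ) :
    HasDerivAt (fun t => mixedPartial D n (s, t)) (mixedPartial D (n + 1) (s, t)) t := by
  have hline : ∀ t : ℝ, Tendsto (fun p : ℕ × ℝ => (p.1, (s, p.2))) (atTop ×ˢ 𝓝 t)
      (atTop ×ˢ 𝓝 (s, t)) := fun t =>
    tendsto_fst.prodMk ((Continuous.prodMk_right s).continuousAt.tendsto.comp tendsto_snd)
  refine hasDerivAt_of_tendsto_nhds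
    (w := fun N t => mixedPartial (fun n i => mollify N (D n i)) n (s, t))
    (w' := fun N t => mixedPartial (fun n i => mollify N (D n i)) (n + 1) (s, t))
    (g' := fun t => mixedPartial D (n + 1) (s, t)) (fun N t => ?_) (fun t => ?_)
    ((continuous_mixedPartial hDc (n + 1)).comp (Continuous.prodMk_right s)) (fun t => ?_) t
  · have h1 : planeDeriv (1, 0) * planeDeriv (0, 1) ^ (n + 1) =
        planeDeriv (0, 1) * (planeDeriv (1, 0) * planeDeriv (0, 1) ^ n) := by
      rw [pow_succ', ← mul_assoc, ← mul_assoc, (planeDeriv_commute _ _).eq]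
    rw [mixedPartial_mollify hDc hD hg hD0, mixedPartial_mollify hDc hD hg hD0, h1]
    exact hasDerivAt_planeDeriv_snd _ s t
  · exact tendsto_mixedPartial_mollify_const hDc n (s, t)
  · have h1 := Tendsto.comp (g := fun p : ℕ × (ℝ × ℝ) =>
      mixedPartial (fun n i => mollify p.1 (D n i)) (n + 1) p.2)
      (tendsto_mixedPartial_mollify hDc (n + 1) (s, t)) (hline t)
    exact h1

end Scalar

section Vector

variable {F : Type*} [AddCommGroup F] [Module ℝ F] [TopologicalSpace F]
  [IsTopologicalAddGroup F] [ContinuousSMul ℝ F] [LocallyConvexSpace ℝ F] [T2Space F]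

/-- A version of Boman's theorem: for a map on the plane which maps smooth curves to smooth
curves, the first partial derivative is smooth along the second coordinate axis. -/
theorem isSmoothCurve_partialDeriv {g : ℝ × ℝ → F} (hg : ConvenientSmoothOn g univ) :
    ∃ d : ℝ → F, IsSmoothCurve d ∧ ∀ t, HasDerivAt (fun s => g (s, t)) (d t) 0 := by
  let D : ℕ → ℕ → ℝ × ℝ → F := fun n i => lineDerivIter g ((i : ℝ), 1) n
  have hDc : ∀ n i, Continuous (D n i) := fun n i => continuous_lineDerivIter hg _ n
  have hgc : Continuous g := continuousOn_univ.1 (hg.continuousOn isOpen_univ)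
  have hl : ∀ (l : StrongDual ℝ F) (n : ℕ) (x : ℝ × ℝ),
      mixedPartial (fun n i x => l (D n i x)) n x = l (mixedPartial D n x) := by
    intro l n x
    simp [mixedPartial]
  have hlD : ∀ (l : StrongDual ℝ F) (n i : ℕ) (x : ℝ × ℝ) (τ : ℝ),
      HasDerivAt (fun τ : ℝ => l (D n i (x + τ • ((i : ℝ), 1))))
        (l (D (n + 1) i (x + τ • ((i : ℝ), 1)))) τ := fun l n i x τ =>
    hasDerivAt_clm_comp l (hasDerivAt_lineDerivIter hg _ n x τ)
  have hlc : ∀ (l : StrongDual ℝ F) (n i : ℕ), Continuous fun x => l (D n i x) :=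
    fun l n i => l.continuous.comp (hDc n i)
  have hl0 : ∀ (l : StrongDual ℝ F) (i : ℕ), (fun x => l (D 0 i x)) = fun x => l (g x) :=
    fun l i => funext fun x => by simp [D, lineDerivIter_zero]
  have hc : ∀ n, Continuous fun t : ℝ => mixedPartial D n (0, t) := fun n =>
    (continuous_mixedPartial hDc n).comp (Continuous.prodMk_right 0)
  refine ⟨fun t => mixedPartial D 0 (0, t),
    ⟨fun n t => mixedPartial D n (0, t), rfl, fun n => ⟨hc n, fun t => ?_⟩⟩, fun t => ?_⟩
  · refine hasDerivAt_of_weak (g := fun t => mixedPartial D n (0, t))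
      (g' := fun t => mixedPartial D (n + 1) (0, t)) (fun l t => ?_) (hc (n + 1)).continuousAt
    have h1 := hasDerivAt_mixedPartial (g := fun x => l (g x)) (hlc l) (hlD l)
      (l.continuous.comp hgc) (hl0 l) n 0 t
    simpa only [hl] using h1
  · refine hasDerivAt_of_weak (g := fun s => g (s, t))
      (g' := fun s => mixedPartial D 0 (s, t)) (fun l s => ?_)
      ((continuous_mixedPartial hDc 0).comp (Continuous.prodMk_left t)).continuousAt
    have h1 := hasDerivAt_mixedPartial_zero (g := fun x => l (g x)) (hlc l) (hlD l)
      (l.continuous.comp hgc) (hl0 l) s t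
    simpa only [hl] using h1

end Vector

end Boman

/-! ### Convenient smooth maps are Gâteaux smooth -/

section Main

theorem _root_.HasGateauxDerivAt.of_hasDerivAt {E : Type u} {F : Type v} [AddCommGroup E]
    [Module ℝ E] [AddCommGroup F] [Module ℝ F] [TopologicalSpace F] [IsTopologicalAddGroup F]
    [ContinuousSMul ℝ F] {f : E → F} {x h : E} {y : F}
    (hf : HasDerivAt (fun s : ℝ => f (x + s • h)) y 0) : HasGateauxDerivAt f y x h := by
  simpa [HasGateauxDerivAt] using hasDerivAt_iff_tendsto_slope_zero_right.1 hf

variable {E : Type u} [AddCommGroup E] [Module ℝ E] [TopologicalSpace E]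
  [IsTopologicalAddGroup E] [ContinuousSMul ℝ E] [T2Space E]
variable {F : Type v} [AddCommGroup F] [Module ℝ F] [TopologicalSpace F]
  [IsTopologicalAddGroup F] [ContinuousSMul ℝ F] [LocallyConvexSpace ℝ F] [T2Space F]

/-- The derivative of a convenient smooth map along a smooth family of lines is locally given by a
smooth curve. -/
theorem _root_.ConvenientSmoothOn.exists_isSmoothCurve_deriv {f : E → F} {U : Set E}
    (hU : IsOpen U) (hf : ConvenientSmoothOn f U) {c v : ℝ → E} (hc : IsSmoothCurve c)
    (hv : IsSmoothCurve v) {t₀ : ℝ} (h₀ : c t₀ ∈ U) :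
    ∃ d : ℝ → F, IsSmoothCurve d ∧
      ∀ᶠ t in 𝓝 t₀, HasDerivAt (fun s : ℝ => f (c t + s • v t)) (d t) 0 := by
  have hcc := (hc.curveCk 0).continuous
  have hvc := (hv.curveCk 0).continuous
  have hG : Continuous fun p : ℝ × ℝ => c (t₀ + p.2) + p.1 • v (t₀ + p.2) := by fun_prop
  have hGU : ∀ᶠ p in 𝓝 ((0 : ℝ), (0 : ℝ)), c (t₀ + p.2) + p.1 • v (t₀ + p.2) ∈ U :=
    hG.continuousAt.eventually_mem (by simpa using hU.mem_nhds h₀)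
  obtain ⟨δ, hδ, hδU⟩ := Metric.eventually_nhds_iff.1 hGU
  obtain ⟨φ, hφ, hφδ, hφe⟩ := exists_isSmoothCurve_cutoff hδ
  -- Cutting off both variables makes the family of lines stay in `U` over the whole plane and
  -- leaves it unchanged near the origin.
  have hg : ConvenientSmoothOn
      (fun p : ℝ × ℝ => f (c (t₀ + φ p.2) + φ p.1 • v (t₀ + φ p.2))) univ := by
    intro γ hγ _
    have h1 : IsSmoothCurve fun t => φ (γ t).1 :=
      hφ.comp (hγ.clm_comp (ContinuousLinearMap.fst ℝ ℝ ℝ))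
    have h2 : IsSmoothCurve fun t => t₀ + φ (γ t).2 :=
      (isSmoothCurve_const t₀).add (hφ.comp (hγ.clm_comp (ContinuousLinearMap.snd ℝ ℝ ℝ)))
    refine hf _ ((hc.comp h2).add (h1.smul (hv.comp h2))) fun t => ?_
    refine @hδU (φ (γ t).1, φ (γ t).2) ?_
    rw [Prod.dist_eq, max_lt_iff, Real.dist_eq, Real.dist_eq, sub_zero, sub_zero]
    exact ⟨hφδ _, hφδ _⟩
  obtain ⟨d, hd, hdg⟩ := isSmoothCurve_partialDeriv hg
  have hsub : IsSmoothCurve fun t : ℝ => t - t₀ :=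
    isSmoothCurve_of_contDiff fun _ => contDiff_id.sub contDiff_const
  refine ⟨fun t => d (t - t₀), hd.comp hsub, ?_⟩
  filter_upwards [Metric.ball_mem_nhds t₀ (half_pos hδ)] with t ht
  have ht' : φ (t - t₀) = t - t₀ := hφe _ (by
    rw [Metric.mem_ball, Real.dist_eq] at ht
    exact ht.le)
  refine hasDerivAt_congr (hdg (t - t₀)) ?_
  filter_upwards [Metric.ball_mem_nhds (0 : ℝ) (half_pos hδ)] with s hs
  have hs' : φ s = s := hφe _ (by
    rw [mem_ball_zero_iff, Real.norm_eq_abs] at hs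
    exact hs.le)
  rw [ht', hs', add_sub_cancel]

/-- The Gâteaux derivative of a convenient smooth map exists and is convenient smooth. -/
theorem _root_.ConvenientSmoothOn.exists_gateauxDeriv {f : E → F} {U : Set E} (hU : IsOpen U)
    (hf : ConvenientSmoothOn f U) :
    ∃ f' : E × E → F, (∀ x ∈ U, ∀ h, HasGateauxDerivAt f (f' (x, h)) x h) ∧
      ConvenientSmoothOn f' (U ×ˢ univ) := by
  -- Where the limit fails to exist this is the default value of `deriv`; over `U` it is the actual
  -- derivative.
  let f' : E × E → F := fun z => deriv (fun s : ℝ => f (z.1 + s • z.2)) 0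
  refine ⟨f', fun x hx h => ?_, fun γ hγ hγU => isSmoothCurve_of_locally fun t₀ => ?_⟩
  · obtain ⟨d, -, hd⟩ := hf.exists_isSmoothCurve_deriv hU (isSmoothCurve_const x)
      (isSmoothCurve_const h) (t₀ := 0) hx
    have h1 := hd.self_of_nhds
    refine HasGateauxDerivAt.of_hasDerivAt ?_
    have h2 : f' (x, h) = d 0 := deriv_eq_of_hasDerivAt h1
    rw [h2]
    exact h1
  · obtain ⟨d, hd, hd'⟩ := hf.exists_isSmoothCurve_deriv hU
      (hγ.clm_comp (ContinuousLinearMap.fst ℝ E E)) (hγ.clm_comp (ContinuousLinearMap.snd ℝ E E))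
      (t₀ := t₀) (hγU t₀).1
    refine ⟨d, hd, ?_⟩
    filter_upwards [hd'] with t ht
    exact deriv_eq_of_hasDerivAt ht

/-- The derivative is convenient smooth on `U × E`, and `E × E` is again first countable and
Hausdorff, so the induction runs over all such spaces at once. -/
theorem _root_.ConvenientSmoothOn.gateauxCkOn (k : ℕ) {E : Type u} [AddCommGroup E] [Module ℝ E]
    [TopologicalSpace E] [IsTopologicalAddGroup E] [ContinuousSMul ℝ E] [T2Space E]
    [FirstCountableTopology E] {f : E → F} {U : Set E} (hU : IsOpen U)
    (hf : ConvenientSmoothOn f U) : GateauxCkOn k f U := by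
  induction k generalizing E with
  | zero => exact hf.continuousOn hU
  | succ k ih =>
    obtain ⟨f', hf1, hf2⟩ := hf.exists_gateauxDeriv hU
    exact ⟨hf.continuousOn hU, f', hf1, ih (hU.prod isOpen_univ) hf2⟩

end Main

end ConvenientCalculus

theorem mainTheorem7 {E : Type u} {F : Type v}
    [AddCommGroup E] [Module ℝ E] [UniformSpace E] [IsFrechetSpace E]
    [AddCommGroup F] [Module ℝ F] [UniformSpace F] [IsFrechetSpace F]
    (U : Set E) (hU : IsCInftyOpen U) :
    IsOpen U ∧ ∀ f : E → F, GateauxSmoothOn f U ↔ ConvenientSmoothOn f U := by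
  have : FirstCountableTopology E := UniformSpace.firstCountableTopology E
  have hUo : IsOpen U := ConvenientCalculus.isOpen_of_isCInftyOpen hU
  exact ⟨hUo, fun f => ⟨fun hf => hf.convenientSmoothOn hUo, fun hf k => hf.gateauxCkOn k hUo⟩⟩
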